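/- **Quantum Sylvester theorem.** For $n\ge 0$ let $\mathrm{Y}(n)=\mathrm{Y}(\mathfrak{gl}_n)$ be the Yangian: the unital associative $\mathbb{C}$-algebra with generators $t_{ij}^{(r)}$, $1\le i,j\le n$, $r\ge 1$, and the defining relations $$[t^{(r+1)}_{ij},t^{(s)}_{kl}]-[t^{(r)}_{ij},t^{(s+1)}_{kl}]=t^{(r)}_{kj}t^{(s)}_{il}-t^{(s)}_{kj}t^{(r)}_{il},\qquad r,s\ge 0,\quad t^{(0)}_{ij}=\delta_{ij}.$$ Put $t_{ij}(u)=\sum_{r\ge 0}t_{ij}^{(r)}u^{-r}\in \mathrm{Y}(n)[[u^{-1}]]$ and $T(u)=(t_{ij}(u))$. For an $N\times N$ matrix $M(u)$ of formal series in $u^{-1}$ with coefficients in an associative $\mathbb{C}$-algebra $\mathcal{A}$, let $M_a(u)\in\mathcal{A}[[u^{-1}]]\otimes(\mathrm{End}\,\mathbb{C}^N)^{\otimes k}$ be $M(u)$ acting on the $a$-th tensor factor, and let $A_k$ be the antisymmetrizer $e_{i_1}\otimes\cdots\otimes e_{i_k}\mapsto\sum_{\sigma\in\mathfrak{S}_k}\mathrm{sgn}\,\sigma\;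 e_{i_{\sigma(1)}}\otimes\cdots\otimes e_{i_{\sigma(k)}}$. The quantum minor $m^{c_1\cdots c_k}_{d_1\cdots d_k}(u)$ of $M(u)$ is the coefficient of $e_{c_1d_1}\otimes\cdots\otimes e_{c_kd_k}$ in $A_kM_1(u)M_2(u-1)\cdots M_k(u-k+1)$ (here $f(u-a)$ is expanded as a series in $u^{-1}$); for $M=T$ the quantum minors are written $t^{c_1\cdots c_k}_{d_1\cdots d_k}(u)$. The quantum determinant $\mathrm{qdet}\,M(u)$ is the series $D(u)$, unique if it exists and then equal to the quantum minor $m^{1\cdots N}_{1\cdots N}(u)$, such that $$A_NM_1(u)\cdots M_N(u-N+1)=M_N(u-N+1)\cdots M_1(u)A_N=A_N\,D(u).$$ Let $1\le m\le n$, let $\mathcal{B}=\{m+1,\dots,n\}$, let $T(u)_{\mathcal{B}\mathcal{B}}$ be the submatrix of $T(u)$ with rows and columns in $\mathcal{B}$, and let $\widetilde T(u)=(\widetilde t_{ij}(u))$ be the $m\times m$ matrix over $\mathrm{Y}(n)[[u^{-1}]]$ with entries $\widetilde t_{ij}(u)=t^{\,i,m+1,\dots,n}_{\,j,m+1,\dots,n}(u)$,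 $1\le i,j\le m$. Then: 1. There is a (unique) homomorphism of unital $\mathbb{C}$-algebras $\mathrm{Y}(m)\to\mathrm{Y}(n)$ which maps $t_{ij}(u)$ to $\widetilde t_{ij}(u)$, coefficient by coefficient, for all $1\le i,j\le m$. 2. The matrices $T(u)$, $T(u)_{\mathcal{B}\mathcal{B}}$ and $\widetilde T(u)$ have quantum determinants, and $$\mathrm{qdet}\,\widetilde T(u)=\mathrm{qdet}\,T(u)\;\mathrm{qdet}\,T(u-1)_{\mathcal{B}\mathcal{B}}\,\cdots\,\mathrm{qdet}\,T(u-m+1)_{\mathcal{B}\mathcal{B}}$$ (for $m=1$ the right-hand side is $\mathrm{qdet}\,T(u)$; the quantum determinant of the empty matrix is $1$). -/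

import Mathlib

open scoped PowerSeries

/-- Generators of the Yangian at the level of the free algebra: `t_{ij}^{(0)} = δ_{ij}`, and
`t_{ij}^{(r+1)}` is the free generator labelled by `(i, j, r)`. -/
def Yangian.freeGen (n : ℕ) (i j : Fin n) : ℕ → FreeAlgebra ℂ (Fin n × Fin n × ℕ)
  | 0 => if i = j then 1 else 0
  | r + 1 => FreeAlgebra.ι ℂ (i, j, r)

/-- The defining relations of the Yangian for `𝔤𝔩ₙ`: for all `r, s ≥ 0`,
`[t_{ij}^{(r+1)}, t_{kl}^{(s)}] - [t_{ij}^{(r)}, t_{kl}^{(s+1)}]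
  = t_{kj}^{(r)} t_{il}^{(s)} - t_{kj}^{(s)} t_{il}^{(r)}`. -/
inductive Yangian.Rel (n : ℕ) :
    FreeAlgebra ℂ (Fin n × Fin n × ℕ) → FreeAlgebra ℂ (Fin n × Fin n × ℕ) → Prop
  | mk (i j k l : Fin n) (r s : ℕ) :
      Yangian.Rel n
        (⁅freeGen n i j (r + 1), freeGen n k l s⁆ - ⁅freeGen n i j r, freeGen n k l (s + 1)⁆)
        (freeGen n k j r * freeGen n i l s - freeGen n k j s * freeGen n i l r)

/-- The Yangian `Y(n) = Y(𝔤𝔩ₙ)`: the unital associative `ℂ`-algebra with generators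
`t_{ij}^{(r)}`, `r ≥ 1`, and the defining relations `Yangian.Rel`. -/
abbrev Yangian (n : ℕ) : Type := RingQuot (Yangian.Rel n)

namespace Yangian

/-- The element `t_{ij}^{(r)}` of `Y(n)`, with `t_{ij}^{(0)} = δ_{ij}`. -/
noncomputable def t (n : ℕ) (i j : Fin n) (r : ℕ) : Yangian n :=
  RingQuot.mkAlgHom ℂ (Rel n) (freeGen n i j r)

/-- The matrix `T(u)`, whose `ij`-th entry is `t_{ij}(u) = ∑_r t_{ij}^{(r)} u^{-r}`.
Formal series in `u⁻¹` are power series, the variable `X` standing for `u⁻¹`. -/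
noncomputable def T (n : ℕ) : Matrix (Fin n) (Fin n) (Yangian n)⟦X⟧ :=
  Matrix.of fun i j => PowerSeries.mk fun r => t n i j r

section QuantumMinors

variable {A : Type*} [Ring A] [Algebra ℂ A]

/-- The series `f(u - a)` for a series `f(u) = ∑_r f_r u^{-r}` in `u⁻¹`: the variable `X = u⁻¹`
is replaced by `(u - a)⁻¹ = X (1 - a X)⁻¹`. The sum over `r` may be cut off at `N`, because
`X (1 - a X)⁻¹` is divisible by `X`. -/
noncomputable def shift (a : ℂ) (f : A⟦X⟧) : A⟦X⟧ :=
  PowerSeries.mk fun N => ∑ r ∈ Finset.range (N + 1),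
    PowerSeries.coeff N
      (((PowerSeries.X : ℂ⟦X⟧) * (1 - PowerSeries.C a * PowerSeries.X)⁻¹) ^ r) •
        PowerSeries.coeff r f

/-- `M_a` for a matrix `M` of size `n`: the matrix `M` acting on the `a`-th copy of
`End ℂⁿ` in the algebra `R ⊗ (End ℂⁿ)^{⊗ k}`. The latter is the algebra of matrices over `R` whose
rows and columns are labelled by the basis `e_{c_1} ⊗ ⋯ ⊗ e_{c_k}` of `(ℂⁿ)^{⊗ k}`. -/
def leg {R : Type*} [Ring R] {n k : ℕ} (a : Fin k) (M : Matrix (Fin n) (Fin n) R) :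
    Matrix (Fin k → Fin n) (Fin k → Fin n) R :=
  Matrix.of fun c d => if ∀ b, b ≠ a → c b = d b then M (c a) (d a) else 0

/-- The antisymmetrizer `A_k` on `(ℂⁿ)^{⊗ k}`, which maps `e_{d_1} ⊗ ⋯ ⊗ e_{d_k}` to
`∑_σ sgn σ · e_{d_{σ(1)}} ⊗ ⋯ ⊗ e_{d_{σ(k)}}`; the `(c, d)` entry is the coefficient of
`e_{c_1} ⊗ ⋯ ⊗ e_{c_k}` in the image of `e_{d_1} ⊗ ⋯ ⊗ e_{d_k}`. -/
def antisymmetrizer (R : Type*) [Ring R] (n k : ℕ) :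
    Matrix (Fin k → Fin n) (Fin k → Fin n) R :=
  Matrix.of fun c d =>
    ∑ σ : Equiv.Perm (Fin k), if c = d ∘ σ then ((Equiv.Perm.sign σ : ℤ) : R) else 0

/-- The list `M_1(u), M_2(u - 1), …, M_k(u - k + 1)` of elements of
`A[[u⁻¹]] ⊗ (End ℂⁿ)^{⊗ k}`. -/
noncomputable def legs {n : ℕ} (k : ℕ) (M : Matrix (Fin n) (Fin n) A⟦X⟧) :
    List (Matrix (Fin k → Fin n) (Fin k → Fin n) A⟦X⟧) :=
  List.ofFn fun a : Fin k => leg a (M.map (shift ((a : ℕ) : ℂ)))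

/-- The quantum minor `m^{c_1 ⋯ c_k}_{d_1 ⋯ d_k}(u)` of the matrix `M(u)`: the coefficient of
`e_{c_1 d_1} ⊗ ⋯ ⊗ e_{c_k d_k}` in `A_k M_1(u) ⋯ M_k(u - k + 1)`. -/
noncomputable def quantumMinor {n k : ℕ} (M : Matrix (Fin n) (Fin n) A⟦X⟧)
    (c d : Fin k → Fin n) : A⟦X⟧ :=
  (antisymmetrizer A⟦X⟧ n k * (legs k M).prod) c d

/-- `D(u)` is the quantum determinant of the `n × n` matrix `M(u)`:
`A_n M_1(u) ⋯ M_n(u - n + 1) = M_n(u - n + 1) ⋯ M_1(u) A_n = A_n D(u)`. -/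
def IsQuantumDet {n : ℕ} (M : Matrix (Fin n) (Fin n) A⟦X⟧) (D : A⟦X⟧) : Prop :=
  antisymmetrizer A⟦X⟧ n n * (legs n M).prod = D • antisymmetrizer A⟦X⟧ n n ∧
    (legs n M).reverse.prod * antisymmetrizer A⟦X⟧ n n = D • antisymmetrizer A⟦X⟧ n n

/-- The quantum determinant `qdet M(u)` of an `n × n` matrix: the quantum minor with upper and lower
indices `1, …, n`. By `IsQuantumDet.eq_qdet` below it is the only candidate for a series `D(u)`
with `IsQuantumDet M D`. -/
noncomputable def qdet {n : ℕ} (M : Matrix (Fin n) (Fin n) A⟦X⟧) : A⟦X⟧ :=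
  quantumMinor M id id

theorem IsQuantumDet.eq_qdet {n : ℕ} {M : Matrix (Fin n) (Fin n) A⟦X⟧} {D : A⟦X⟧}
    (h : IsQuantumDet M D) : D = qdet M := by
  have h1 := congrFun (congrFun h.1 id) id
  have h2 : antisymmetrizer A⟦X⟧ n n id id = 1 := by
    have h3 : ∀ σ : Equiv.Perm (Fin n), ((id : Fin n → Fin n) = ⇑σ) ↔ σ = 1 := fun σ =>
      ⟨fun hs => Equiv.ext fun x => (congrFun hs x).symm, fun hs => by rw [hs]; rfl⟩
    simp [antisymmetrizer, h3]
  rw [Matrix.smul_apply, h2] at h1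
  simpa [qdet, quantumMinor] using h1.symm

end QuantumMinors

/-- The tuple `(m+1, …, n)` of the elements of `B`, in increasing order. -/
def tupleB {m n : ℕ} (h : m ≤ n) (b : Fin (n - m)) : Fin n :=
  ⟨m + b, by omega⟩

/-- The tuple `(i, m+1, …, n)` for an index `1 ≤ i ≤ m`. -/
def tupleConsB {m n : ℕ} (h : m ≤ n) (i : Fin m) : Fin (n - m + 1) → Fin n :=
  Fin.cons (Fin.castLE h i) (tupleB h)

/-- The `m × m` matrix `T̃(u)` with the entries `t̃_{ij}(u) = t^{i,m+1,…,n}_{j,m+1,…,n}(u)`. -/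
noncomputable def Ttilde {m n : ℕ} (h : m ≤ n) : Matrix (Fin m) (Fin m) (Yangian n)⟦X⟧ :=
  Matrix.of fun i j => quantumMinor (T n) (tupleConsB h i) (tupleConsB h j)

/-- The submatrix `T(u)_{BB}` of `T(u)`, where `B = {m+1, …, n}`. -/
noncomputable def TBB {m n : ℕ} (h : m ≤ n) :
    Matrix (Fin (n - m)) (Fin (n - m)) (Yangian n)⟦X⟧ :=
  (T n).submatrix (tupleB h) (tupleB h)

end Yangian

/-!
The relations of the Yangian say that the `R`-matrix `u - v - P` intertwines `T₁(u) T₂(v)` and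
`T₂(v) T₁(u)`. In this form they pass to the inverse of a matrix, hence to the inverse of a block
of the inverse, which is the Schur complement `S(u)` of `T(u)_{BB}`; they also show that the entries
of `S(u)` commute with those of `T(v)_{BB}`.

On the other hand, at `v = u - 1` the relations say that the column forms `∑_i ξ_i t_{ij}(u)` over
an exterior algebra anticommute up to the shift of `u`, so that quantum minors can be computed by
block elimination. This gives `t̃_{ij}(u) = qdet T(u)_{BB} · s_{ij}(u - n + m)` and
`qdet T(u) = qdet T(u)_{BB} · qdet S(u - n + m)`. Thus `T̃(u)` satisfies the relations of the
Yangian since `S(u)` does, and `qdet T̃(u)` is `qdet S(u - n + m)` times the product of the shifts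
of `qdet T(u)_{BB}`, of which the first is absorbed into `qdet T(u)`.

The row-ordered minors in the second half of the definition of a quantum determinant are the
column-ordered ones of the transpose over the opposite ring. Adding one row and column at a time
multiplies both kinds by the same factor, so they agree.
-/

namespace Yangian

open PowerSeries (X C coeff constantCoeff)
open Finset.HasAntidiagonal (antidiagonal mem_antidiagonal)

section Shift

variable {A : Type*} [Ring A] [Algebra ℂ A]

/-- The expansion `X (1 - a X)⁻¹` of `(u - a)⁻¹` in powers of `X = u⁻¹`. -/
noncomputable def shiftVar (a : ℂ) : ℂ⟦X⟧ := X * (1 - C a * X)⁻¹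

theorem one_sub_mul_shiftVar (a : ℂ) : (1 - C a * X) * shiftVar a = X := by
  rw [shiftVar, mul_left_comm, PowerSeries.mul_inv_cancel _ (by simp), mul_one]

theorem coeff_shiftVar_pow_of_lt (a : ℂ) {N r : ℕ} (h : N < r) : coeff N (shiftVar a ^ r) = 0 := by
  rw [shiftVar, mul_pow, PowerSeries.coeff_X_pow_mul', if_neg (by omega)]

theorem coeff_shift (a : ℂ) (f : A⟦X⟧) {N K : ℕ} (h : N ≤ K) :
    coeff N (shift a f) =
      ∑ r ∈ Finset.range (K + 1), coeff N (shiftVar a ^ r) • coeff r f := by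
  rw [shift, PowerSeries.coeff_mk]
  refine Finset.sum_subset (Finset.range_mono (by omega)) fun r _ hr => ?_
  have h_zero := coeff_shiftVar_pow_of_lt a (N := N) (r := r) (by simpa using hr)
  rw [shiftVar] at h_zero
  rw [h_zero, zero_smul]

theorem sum_range_sum_antidiagonal {G : Type*} [AddCommMonoid G] (N : ℕ) (F : ℕ → ℕ → G)
    (hF : ∀ p q, N < p + q → F p q = 0) :
    ∑ r ∈ Finset.range (N + 1), ∑ x ∈ antidiagonal r, F x.1 x.2 =
      ∑ p ∈ Finset.range (N + 1), ∑ q ∈ Finset.range (N + 1), F p q := by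
  simp only [Finset.Nat.sum_antidiagonal_eq_sum_range_succ F, Nat.succ_eq_add_one]
  rw [Finset.sum_range_diag_flip]
  refine Finset.sum_congr rfl fun p _ => ?_
  refine Finset.sum_subset (Finset.range_mono (Nat.sub_le _ _)) fun q _ hq => hF p q ?_
  rw [Finset.mem_range] at hq
  omega

theorem shift_mul (a : ℂ) (f g : A⟦X⟧) : shift a (f * g) = shift a f * shift a g := by
  ext N
  let F (x : ℕ × ℕ) (p q : ℕ) : A :=
    (coeff x.1 (shiftVar a ^ p) * coeff x.2 (shiftVar a ^ q)) • (coeff p f * coeff q g)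
  have sum_F (p q : ℕ) : ∑ x ∈ antidiagonal N, F x p q =
      coeff N (shiftVar a ^ (p + q)) • (coeff p f * coeff q g) := by
    rw [← Finset.sum_smul, pow_add, PowerSeries.coeff_mul]
  calc coeff N (shift a (f * g))
    _ = ∑ r ∈ Finset.range (N + 1), ∑ x ∈ antidiagonal r,
          coeff N (shiftVar a ^ (x.1 + x.2)) • (coeff x.1 f * coeff x.2 g) := by
      rw [coeff_shift a _ le_rfl]
      refine Finset.sum_congr rfl fun r _ => ?_
      rw [PowerSeries.coeff_mul, Finset.smul_sum]
      refine Finset.sum_congr rfl fun x hx => ?_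
      rw [mem_antidiagonal.mp hx]
    _ = ∑ p ∈ Finset.range (N + 1), ∑ q ∈ Finset.range (N + 1),
          ∑ x ∈ antidiagonal N, F x p q := by
      simp only [sum_F]
      refine sum_range_sum_antidiagonal N
        (fun p q => coeff N (shiftVar a ^ (p + q)) • (coeff p f * coeff q g)) fun p q hpq => ?_
      rw [coeff_shiftVar_pow_of_lt a hpq, zero_smul]
    _ = ∑ x ∈ antidiagonal N,
          ∑ p ∈ Finset.range (N + 1), ∑ q ∈ Finset.range (N + 1), F x p q := by
      rw [Finset.sum_comm (s := antidiagonal N)]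
      exact Finset.sum_congr rfl fun p _ => Finset.sum_comm
    _ = coeff N (shift a f * shift a g) := by
      rw [PowerSeries.coeff_mul]
      refine Finset.sum_congr rfl fun x hx => ?_
      rw [coeff_shift a f (Finset.HasAntidiagonal.antidiagonal.fst_le hx),
        coeff_shift a g (Finset.HasAntidiagonal.antidiagonal.snd_le hx), Finset.sum_mul_sum]
      simp only [F, smul_mul_smul_comm]

theorem shift_C (a : ℂ) (x : A) : shift a (C x) = C x := by
  ext N
  rw [coeff_shift a _ le_rfl, Finset.sum_eq_single 0]
  · simp only [pow_zero, PowerSeries.coeff_one, PowerSeries.coeff_C, if_true]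
    split_ifs <;> simp
  · intro r _ hr
    simp [PowerSeries.coeff_C, hr]
  · simp

theorem shift_add (a : ℂ) (f g : A⟦X⟧) : shift a (f + g) = shift a f + shift a g := by
  ext N
  simp only [map_add, coeff_shift a _ le_rfl, smul_add, Finset.sum_add_distrib]

/-- The substitution `f(u) ↦ f(u - a)` as a ring homomorphism. -/
noncomputable def shiftHom (A : Type*) [Ring A] [Algebra ℂ A] (a : ℂ) : A⟦X⟧ →+* A⟦X⟧ where
  toFun := shift a
  map_one' := by simpa using shift_C a (1 : A)
  map_mul' := shift_mul a
  map_zero' := by simpa using shift_C a (0 : A)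
  map_add' := shift_add a

@[simp] theorem shiftHom_apply (a : ℂ) (f : A⟦X⟧) : shiftHom A a f = shift a f := rfl

theorem shift_map {A' : Type*} [Ring A'] [Algebra ℂ A'] (a : ℂ) (φ : A →ₐ[ℂ] A') (f : A⟦X⟧) :
    shift a (PowerSeries.map (φ : A →+* A') f) = PowerSeries.map (φ : A →+* A') (shift a f) := by
  ext N
  simp [coeff_shift a _ le_rfl]

theorem shift_X (a : ℂ) : shift a (X : A⟦X⟧) = PowerSeries.map (algebraMap ℂ A) (shiftVar a) := by
  ext N
  rw [coeff_shift a _ (Nat.le_succ N), Finset.sum_eq_single 1]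
  · simp [Algebra.algebraMap_eq_smul_one]
  · intro r _ hr
    simp [PowerSeries.coeff_X, hr]
  · simp

theorem one_sub_mul_shift_X (a : ℂ) :
    (1 - algebraMap ℂ A⟦X⟧ a * X) * shift a (X : A⟦X⟧) = X := by
  rw [shift_X, PowerSeries.algebraMap_apply]
  simpa using congrArg (PowerSeries.map (algebraMap ℂ A)) (one_sub_mul_shiftVar a)

theorem shift_shiftVar (a b : ℂ) : shift a (shiftVar b) = shiftVar (a + b) := by
  have shifted := congrArg (shiftHom ℂ a) (one_sub_mul_shiftVar b)
  have hX : shift a (X : ℂ⟦X⟧) = shiftVar a := by simpa using shift_X (A := ℂ) a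
  simp only [map_mul, map_sub, map_one, shiftHom_apply, shift_C, hX] at shifted
  have hne : (1 - C (a + b) * X : ℂ⟦X⟧) ≠ 0 := fun h => by
    simpa using congrArg constantCoeff h
  apply mul_left_cancel₀ hne
  rw [one_sub_mul_shiftVar (a + b), map_add]
  linear_combination (1 - C a * X) * shifted +
    (C b * shift a (shiftVar b) + 1) * one_sub_mul_shiftVar a

theorem shift_shift (a b : ℂ) (f : A⟦X⟧) : shift a (shift b f) = shift (a + b) f := by
  ext N
  have coeff_pow (s : ℕ) : coeff N (shiftVar (a + b) ^ s) = ∑ r ∈ Finset.range (N + 1),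
      coeff N (shiftVar a ^ r) * coeff r (shiftVar b ^ s) := by
    rw [← shift_shiftVar, ← shiftHom_apply, ← map_pow, shiftHom_apply, coeff_shift a _ le_rfl]
    rfl
  rw [coeff_shift a _ le_rfl, coeff_shift (a + b) _ le_rfl]
  simp only [coeff_pow, Finset.sum_smul]
  rw [Finset.sum_comm]
  refine Finset.sum_congr rfl fun r hr => ?_
  rw [coeff_shift b _ (Nat.lt_succ_iff.mp (Finset.mem_range.mp hr)), Finset.smul_sum]
  simp only [mul_smul]

theorem shift_zero (f : A⟦X⟧) : shift 0 f = f := by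
  ext N
  rw [coeff_shift 0 _ le_rfl, Finset.sum_eq_single N]
  · simp [shiftVar, PowerSeries.coeff_X_pow]
  · intro r _ hr
    simp [shiftVar, PowerSeries.coeff_X_pow, Ne.symm hr]
  · simp

theorem shift_natCast (k : ℕ) (f : A⟦X⟧) : shift (k : ℂ) f = (shiftHom A 1 ^ k) f := by
  induction k with
  | zero => simp [shift_zero]
  | succ k ih =>
    rw [pow_succ', RingHom.mul_def, RingHom.comp_apply, ← ih, shiftHom_apply, shift_shift]
    push_cast
    rw [add_comm]

theorem constantCoeff_shift (a : ℂ) (f : A⟦X⟧) :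
    constantCoeff (shift a f) = constantCoeff f := by
  rw [← PowerSeries.coeff_zero_eq_constantCoeff_apply, coeff_shift a _ le_rfl]
  simp

end Shift

section TwistedProduct

/-- The product `x₀ τ(x₁) τ²(x₂) ⋯` of a list. With `τ` the shift `f(u) ↦ f(u - 1)` it gives the
products `f₀(u) f₁(u - 1) f₂(u - 2) ⋯` of the quantum minors. -/
def twistedProd {Q : Type*} [Semiring Q] (τ : Q →+* Q) : List Q → Q
  | [] => 1
  | x :: l => x * τ (twistedProd τ l)

section Semiring

variable {Q : Type*} [Semiring Q] (τ : Q →+* Q)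

theorem pow_succ_apply (k : ℕ) (x : Q) : (τ ^ (k + 1)) x = τ ((τ ^ k) x) := by
  rw [pow_succ', RingHom.mul_def, RingHom.comp_apply]

@[simp] theorem twistedProd_nil : twistedProd τ [] = 1 := rfl

@[simp] theorem twistedProd_cons (x : Q) (l : List Q) :
    twistedProd τ (x :: l) = x * τ (twistedProd τ l) := rfl

theorem twistedProd_append (l l' : List Q) :
    twistedProd τ (l ++ l') = twistedProd τ l * (τ ^ l.length) (twistedProd τ l') := by
  induction l with
  | nil => simp
  | cons x l ih =>
    rw [List.cons_append, twistedProd_cons, ih, List.length_cons, pow_succ_apply, map_mul,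
      twistedProd_cons, mul_assoc]

theorem twistedProd_append_singleton (l : List Q) (x : Q) :
    twistedProd τ (l ++ [x]) = twistedProd τ l * (τ ^ l.length) x := by
  simp [twistedProd_append]

theorem twistedProd_ofFn {k : ℕ} (f : Fin k → Q) :
    twistedProd τ (List.ofFn f) = (List.ofFn fun a : Fin k => (τ ^ (a : ℕ)) (f a)).prod := by
  induction k with
  | zero => simp
  | succ k ih =>
    simp only [List.ofFn_succ, twistedProd_cons, ih, List.prod_cons, map_list_prod, List.map_ofFn,
      Function.comp_def, Fin.val_zero, pow_zero, RingHom.one_def, RingHom.id_apply, Fin.val_succ,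
      pow_succ_apply]

theorem twistedProd_map {Q' : Type*} [Semiring Q'] {τ' : Q' →+* Q'} {ρ : Q →+* Q'}
    (h : ∀ x, τ' (ρ x) = ρ (τ x)) (l : List Q) :
    twistedProd τ' (l.map ρ) = ρ (twistedProd τ l) := by
  induction l with
  | nil => simp
  | cons x l ih => simp [ih, h]

end Semiring

variable {Q : Type*} [Ring Q] {τ : Q →+* Q} {κ : Type*} {Ψ : κ → Q}

/-- The relations `Ψ_a τ(Ψ_a) = 0` and `Ψ_a τ(Ψ_b) = -Ψ_b τ(Ψ_a)`, which make the twisted products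
of the elements `Ψ_a` alternating. -/
structure TwistedAnticommute (τ : Q →+* Q) (Ψ : κ → Q) : Prop where
  mul_self (a : κ) : Ψ a * τ (Ψ a) = 0
  mul_swap (a b : κ) : Ψ a * τ (Ψ b) = -(Ψ b * τ (Ψ a))

namespace TwistedAnticommute

theorem twistedProd_comp_swap (hΨ : TwistedAnticommute τ Ψ) {k : ℕ} (d : Fin (k + 1) → κ)
    (i : Fin k) :
    twistedProd τ (List.ofFn (Ψ ∘ d ∘ Equiv.swap i.castSucc i.succ)) =
      -twistedProd τ (List.ofFn (Ψ ∘ d)) := by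
  induction k with
  | zero => exact i.elim0
  | succ k ih =>
    cases i using Fin.cases with
    | zero =>
      have swap_zero : Equiv.swap (0 : Fin (k + 2)) 1 0 = 1 := Equiv.swap_apply_left _ _
      have swap_one : Equiv.swap (0 : Fin (k + 2)) 1 1 = 0 := Equiv.swap_apply_right _ _
      have swap_succ_succ (j : Fin k) : Equiv.swap (0 : Fin (k + 2)) 1 j.succ.succ = j.succ.succ :=
        Equiv.swap_apply_of_ne_of_ne (by simp [Fin.ext_iff]) (by simp [Fin.ext_iff])
      simp only [List.ofFn_succ, Function.comp_apply, Fin.castSucc_zero, Fin.succ_zero_eq_one,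
        swap_zero, swap_one, swap_succ_succ, twistedProd_cons, map_mul, ← mul_assoc]
      rw [hΨ.mul_swap (d 1), neg_mul]
    | succ i =>
      have swap_zero : Equiv.swap i.succ.castSucc i.succ.succ 0 = 0 :=
        Equiv.swap_apply_of_ne_of_ne (by simp [Fin.ext_iff]) (by simp [Fin.ext_iff])
      have swap_succ (j : Fin (k + 1)) : Equiv.swap i.succ.castSucc i.succ.succ j.succ =
          (Equiv.swap i.castSucc i.succ j).succ := by
        rw [← Fin.succ_castSucc]
        exact ((Fin.succ_injective _).map_swap _ _ _).symm
      have tail := ih (d ∘ Fin.succ) i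
      simp only [Function.comp_def] at tail ⊢
      rw [List.ofFn_succ, List.ofFn_succ (f := fun j => Ψ (d j))]
      simp only [swap_zero, swap_succ, twistedProd_cons, tail, map_neg, mul_neg]

theorem twistedProd_cons_append_self (hΨ : TwistedAnticommute τ Ψ) (c : κ) (l : List κ) :
    twistedProd τ ((c :: (l ++ [c])).map Ψ) = 0 := by
  induction l with
  | nil => simpa using hΨ.mul_self c
  | cons b l ih =>
    simp only [List.cons_append, List.map_cons, twistedProd_cons, map_mul] at ih ⊢
    rw [← mul_assoc, hΨ.mul_swap c b, neg_mul, mul_assoc, ← map_mul, ih, map_zero, mul_zero,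
      neg_zero]

theorem twistedProd_append_of_mem (hΨ : TwistedAnticommute τ Ψ) {c : κ} {l : List κ} (hc : c ∈ l) :
    twistedProd τ ((l ++ [c]).map Ψ) = 0 := by
  induction l with
  | nil => simp at hc
  | cons b l ih =>
    by_cases hl : c ∈ l
    · rw [List.cons_append, List.map_cons, twistedProd_cons, ih hl, map_zero, mul_zero]
    · obtain rfl : c = b := by simpa [hl] using hc
      exact hΨ.twistedProd_cons_append_self c l

theorem twistedProd_append_eliminate (hΨ : TwistedAnticommute τ Ψ) {β μ : Type*} [Fintype β]
    {b : β → κ} {l : List κ} (hb : ∀ γ, b γ ∈ l) {d : μ → κ} {x : β → μ → Q} {S : μ → Q}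
    (hd : ∀ j, Ψ (d j) = ∑ γ, Ψ (b γ) * x γ j + S j) (l' : List μ) :
    twistedProd τ (l.map Ψ ++ l'.map (Ψ ∘ d)) = twistedProd τ (l.map Ψ ++ l'.map S) := by
  induction l' using List.reverseRecOn with
  | nil => rfl
  | append_singleton l' j ih =>
    have drop (γ : β) : twistedProd τ (l.map Ψ ++ l'.map (Ψ ∘ d)) *
        (τ ^ (l.map Ψ ++ l'.map (Ψ ∘ d)).length) (Ψ (b γ)) = 0 := by
      have h := hΨ.twistedProd_append_of_mem (c := b γ) (l := l ++ l'.map d) (by simp [hb])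
      rwa [List.map_append, List.map_append, List.map_map, List.map_singleton,
        twistedProd_append_singleton] at h
    rw [List.map_append, List.map_append, ← List.append_assoc, ← List.append_assoc,
      List.map_singleton, List.map_singleton, twistedProd_append_singleton,
      twistedProd_append_singleton, ← ih, Function.comp_apply, hd j, map_add, map_sum, mul_add,
      Finset.mul_sum, Finset.sum_eq_zero, zero_add]
    · simp only [List.length_append, List.length_map]
    · intro γ _
      rw [map_mul, ← mul_assoc, drop, zero_mul]

end TwistedAnticommute

end TwistedProduct

section TwistedMinor

open TensorProduct

theorem comp_append {X Y : Type*} {k m : ℕ} (e : X → Y) (f : Fin k → X) (g : Fin m → X) :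
    e ∘ Fin.append f g = Fin.append (e ∘ f) (e ∘ g) := by
  ext a
  refine Fin.addCases (fun i => ?_) (fun i => ?_) a <;> simp

theorem comp_perm_eq_sign_smul {G X : Type*} [AddCommGroup G] {k : ℕ} (F : (Fin (k + 1) → X) → G)
    (hF : ∀ (d : Fin (k + 1) → X) (i : Fin k), F (d ∘ Equiv.swap i.castSucc i.succ) = -F d)
    (d : Fin (k + 1) → X) (π : Equiv.Perm (Fin (k + 1))) :
    F (d ∘ π) = Equiv.Perm.sign π • F d := by
  have hπ : π ∈ Submonoid.closure
      (Set.range fun i : Fin k => Equiv.swap i.castSucc i.succ) := by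
    rw [Equiv.Perm.mclosure_swap_castSucc_succ]
    trivial
  induction hπ using Submonoid.closure_induction generalizing d with
  | mem x hx =>
    obtain ⟨i, rfl⟩ := hx
    rw [hF, Equiv.Perm.sign_swap (by simp [Fin.ext_iff]), Units.neg_smul, one_smul]
  | one => simp
  | mul x y _ _ hx hy =>
    rw [Equiv.Perm.coe_mul, ← Function.comp_assoc, hy, hx, Equiv.Perm.sign_mul, smul_smul, mul_comm]

theorem det_one_submatrix_append {k m : ℕ} (e : Fin k → Fin (k + m)) (f : Fin m → Fin m) :
    ((1 : Matrix (Fin (k + m)) (Fin (k + m)) ℤ).submatrix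
        (Fin.append e (Fin.natAdd k ∘ f)) id).det =
      ((1 : Matrix (Fin (k + m)) (Fin (k + m)) ℤ).submatrix e (Fin.castAdd m)).det *
        ((1 : Matrix (Fin m) (Fin m) ℤ).submatrix f id).det := by
  rw [← Matrix.det_submatrix_equiv_self finSumFinEquiv, ← Matrix.fromBlocks_toBlocks
    (Matrix.submatrix (Matrix.submatrix _ _ _) _ _)]
  have lower_left : (((1 : Matrix (Fin (k + m)) (Fin (k + m)) ℤ).submatrix
      (Fin.append e (Fin.natAdd k ∘ f)) id).submatrix
        finSumFinEquiv finSumFinEquiv).toBlocks₂₁ = 0 := by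
    ext a j
    simp [Matrix.toBlocks₂₁, Matrix.one_apply, Fin.ext_iff]
    omega
  rw [lower_left, Matrix.det_fromBlocks_zero₂₁]
  congr 2
  · ext a j
    simp [Matrix.toBlocks₁₁, Matrix.one_apply]
  · ext a j
    simp [Matrix.toBlocks₂₂, Matrix.one_apply, Fin.ext_iff]

theorem sum_det_one_submatrix_smul {G X : Type*} [AddCommGroup G] [Fintype X] [DecidableEq X]
    {k : ℕ} (g : Fin k → X) (F : (Fin k → X) → G) :
    ∑ e : Fin k → X, ((1 : Matrix X X ℤ).submatrix e g).det • F e =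
      ∑ σ : Equiv.Perm (Fin k), Equiv.Perm.sign σ • F (g ∘ σ) := by
  have prod_entries (e : Fin k → X) (σ : Equiv.Perm (Fin k)) :
      ∏ i, (1 : Matrix X X ℤ).submatrix e g (σ i) i = if e = g ∘ ⇑σ⁻¹ then 1 else 0 := by
    simp only [Matrix.submatrix_apply, Matrix.one_apply, Finset.prod_ite_zero,
      Finset.prod_const_one, Finset.mem_univ, true_imp_iff]
    congr 1
    refine propext ⟨fun h => funext fun a => ?_, fun h i => ?_⟩
    · simpa using h (σ⁻¹ a)
    · simp [h]
  simp only [Matrix.det_apply', prod_entries, Finset.sum_smul, mul_ite, mul_one, mul_zero,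
    ite_smul, zero_smul]
  rw [Finset.sum_comm]
  simp only [Finset.sum_ite_eq', Finset.mem_univ, if_true]
  refine Fintype.sum_equiv (Equiv.inv _) _ _ fun σ => ?_
  simp [Units.smul_def]

variable {P : Type*} [Ring P] (τ : P →+* P) {ι κ : Type*}

/-- The column-ordered minor `∑_σ sgn σ · m_{c(σ 0), d(0)} τ(m_{c(σ 1), d(1)}) ⋯`; with `τ` the
shift `f(u) ↦ f(u - 1)` this is the quantum minor. -/
def twistedMinor (M : Matrix ι κ P) {k : ℕ} (c : Fin k → ι) (d : Fin k → κ) : P :=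
  ∑ σ : Equiv.Perm (Fin k),
    Equiv.Perm.sign σ • twistedProd τ (List.ofFn fun a => M (c (σ a)) (d a))

theorem twistedMinor_map {P' : Type*} [Ring P'] {τ' : P' →+* P'} {ρ : P →+* P'}
    (h : ∀ x, τ' (ρ x) = ρ (τ x)) (M : Matrix ι κ P) {k : ℕ} (c : Fin k → ι) (d : Fin k → κ) :
    twistedMinor τ' (M.map ρ) c d = ρ (twistedMinor τ M c d) := by
  simp only [twistedMinor, map_sum, Units.smul_def, map_zsmul, ← twistedProd_map τ h, List.map_ofFn]
  rfl

theorem twistedMinor_one (k : ℕ) : twistedMinor τ (1 : Matrix (Fin k) (Fin k) P) id id = 1 := by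
  rw [twistedMinor, Finset.sum_eq_single 1]
  · rw [Equiv.Perm.sign_one, one_smul, twistedProd_ofFn, List.prod_eq_one]
    intro x hx
    obtain ⟨a, rfl⟩ := List.mem_ofFn.mp hx
    rw [id, id, Equiv.Perm.one_apply, Matrix.one_apply_eq, map_one]
  · intro σ _ hσ
    obtain ⟨a, ha⟩ : ∃ a, σ a ≠ a := not_forall.mp fun h => hσ (Equiv.ext h)
    rw [twistedProd_ofFn, List.prod_eq_zero, smul_zero]
    exact List.mem_ofFn.mpr ⟨a, by rw [id, id, Matrix.one_apply_ne ha, map_zero]⟩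
  · simp

theorem twistedMinor_comp_perm_left (M : Matrix ι κ P) {k : ℕ} (c : Fin k → ι) (d : Fin k → κ)
    (π : Equiv.Perm (Fin k)) :
    twistedMinor τ M (c ∘ π) d = Equiv.Perm.sign π • twistedMinor τ M c d := by
  rw [twistedMinor, twistedMinor, Finset.smul_sum]
  refine Fintype.sum_equiv (Equiv.mulLeft π) _ _ fun σ => ?_
  rw [smul_smul, Equiv.coe_mulLeft, Equiv.Perm.sign_mul, ← mul_assoc, Int.units_mul_self, one_mul]
  rfl

/-- The relations on a matrix `M` with a twist `τ` which say that the column forms `∑_i ξ_i m_{ij}`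
in anticommuting variables `ξ_i` satisfy `TwistedAnticommute τ`. Without the twist these are the
Manin matrices. -/
structure IsTwistedManin (M : Matrix ι κ P) : Prop where
  column (i k : ι) (j : κ) : M i j * τ (M k j) = M k j * τ (M i j)
  cross (i k : ι) (j l : κ) :
    M i j * τ (M k l) + M i l * τ (M k j) = M k j * τ (M i l) + M k l * τ (M i j)

variable {τ} in
theorem IsTwistedManin.submatrix {M : Matrix ι κ P} (hM : IsTwistedManin τ M) {ι' κ' : Type*}
    (e : ι' → ι) (f : κ' → κ) : IsTwistedManin τ (M.submatrix e f) :=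
  ⟨fun i k j => hM.column (e i) (e k) (f j), fun i k j l => hM.cross (e i) (e k) (f j) (f l)⟩

/-- The exterior algebra on `n` generators with coefficients in `P`. -/
abbrev ExtCoeff (P : Type*) [Ring P] (n : ℕ) : Type _ :=
  ExteriorAlgebra ℤ (Fin n → ℤ) ⊗[ℤ] P

/-- The generators `ξ_i` of the exterior algebra on `n` generators. -/
noncomputable def extGen {n : ℕ} (i : Fin n) : ExteriorAlgebra ℤ (Fin n → ℤ) :=
  ExteriorAlgebra.ι ℤ (Pi.single i 1)

theorem extGen_mul_self {n : ℕ} (i : Fin n) : extGen i * extGen i = 0 :=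
  ExteriorAlgebra.ι_sq_zero _

theorem extGen_mul_swap {n : ℕ} (i j : Fin n) : extGen i * extGen j = -(extGen j * extGen i) :=
  eq_neg_of_add_eq_zero_left (ExteriorAlgebra.ι_add_mul_swap _ _)

theorem sum_extGen_mul_tmul_eq_zero {n : ℕ} (f : Fin n → Fin n → P) (hf : ∀ i k, f i k = f k i) :
    ∑ i, ∑ k, (extGen i * extGen k) ⊗ₜ[ℤ] f i k = 0 := by
  rw [← Fintype.sum_prod_type' (f := fun i k => (extGen i * extGen k) ⊗ₜ[ℤ] f i k)]
  refine Finset.sum_involution (fun x _ => x.swap) (fun x _ => ?_) (fun x _ hx hswap => hx ?_)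
    (fun _ _ => Finset.mem_univ _) (fun _ _ => rfl)
  · rw [Prod.fst_swap, Prod.snd_swap, extGen_mul_swap x.1, hf x.1, neg_tmul, neg_add_cancel]
  · rw [← congrArg Prod.fst hswap, Prod.fst_swap, extGen_mul_self, zero_tmul]

/-- The twist `τ` acting on the coefficients of the exterior algebra. -/
noncomputable def extMap (n : ℕ) : ExtCoeff P n →+* ExtCoeff P n :=
  (Algebra.TensorProduct.map (AlgHom.id ℤ _) τ.toIntAlgHom).toRingHom

@[simp] theorem extMap_tmul (n : ℕ) (x : ExteriorAlgebra ℤ (Fin n → ℤ)) (p : P) :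
    extMap τ n (x ⊗ₜ p) = x ⊗ₜ τ p := rfl

theorem extMap_pow_tmul (n r : ℕ) (x : ExteriorAlgebra ℤ (Fin n → ℤ)) (p : P) :
    (extMap τ n ^ r) (x ⊗ₜ p) = x ⊗ₜ (τ ^ r) p := by
  induction r with
  | zero => rfl
  | succ r ih => rw [pow_succ_apply, pow_succ_apply, ih, extMap_tmul]

/-- The form `∑_i ξ_i m_i`. -/
noncomputable def linForm {n r : ℕ} (ξ : Fin r → ExteriorAlgebra ℤ (Fin n → ℤ)) (m : Fin r → P) :
    ExtCoeff P n :=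
  ∑ i, ξ i ⊗ₜ m i

theorem linForm_mul_extMap {n : ℕ} (p q : Fin n → P) :
    linForm extGen p * extMap τ n (linForm extGen q) =
      ∑ i, ∑ k, (extGen i * extGen k) ⊗ₜ[ℤ] (p i * τ (q k)) := by
  simp only [linForm, map_sum, extMap_tmul, Finset.sum_mul_sum,
    Algebra.TensorProduct.tmul_mul_tmul]

variable {τ} in
theorem IsTwistedManin.twistedAnticommute {n : ℕ} {M : Matrix (Fin n) κ P}
    (hM : IsTwistedManin τ M) :
    TwistedAnticommute (extMap τ n) fun j => linForm extGen fun i => M i j where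
  mul_self j := by
    rw [linForm_mul_extMap]
    exact sum_extGen_mul_tmul_eq_zero _ fun i k => hM.column i k j
  mul_swap j l := by
    rw [eq_neg_iff_add_eq_zero, linForm_mul_extMap, linForm_mul_extMap]
    simp only [← Finset.sum_add_distrib, ← tmul_add]
    exact sum_extGen_mul_tmul_eq_zero _ fun i k => hM.cross i k j l

theorem twistedProd_linForm {n r k : ℕ} (ξ : Fin r → ExteriorAlgebra ℤ (Fin n → ℤ))
    (N : Matrix (Fin r) (Fin k) P) :
    twistedProd (extMap τ n) (List.ofFn fun a => linForm ξ fun i => N i a) =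
      ∑ e : Fin k → Fin r, (List.ofFn fun a => ξ (e a)).prod ⊗ₜ
        twistedProd τ (List.ofFn fun a => N (e a) a) := by
  induction k with
  | zero => simp [Algebra.TensorProduct.one_def]
  | succ k ih =>
    rw [List.ofFn_succ, twistedProd_cons, ih (fun i a => N i a.succ), linForm, map_sum,
      Finset.sum_mul_sum, ← (Fin.consEquiv fun _ => Fin r).sum_comp, Fintype.sum_prod_type]
    simp [Fin.consEquiv]

/-- The coefficient functional of `ξ_1 ⋯ ξ_n` on the exterior algebra. -/
noncomputable def topCoeff (n : ℕ) : ExteriorAlgebra ℤ (Fin n → ℤ) →ₗ[ℤ] ℤ :=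
  ExteriorAlgebra.liftAlternating (Pi.single n Matrix.detRowAlternating)

theorem topCoeff_prod {n : ℕ} (e : Fin n → Fin n) :
    topCoeff n (List.ofFn fun a => extGen (e a)).prod =
      ((1 : Matrix (Fin n) (Fin n) ℤ).submatrix e id).det := by
  have prod_eq : (List.ofFn fun a => extGen (e a)).prod =
      ExteriorAlgebra.ιMulti ℤ n (fun a => Pi.single (e a) (1 : ℤ)) := by
    rw [ExteriorAlgebra.ιMulti_apply]
    rfl
  rw [prod_eq, topCoeff, ExteriorAlgebra.liftAlternating_apply_ιMulti, Pi.single_eq_same]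
  change Matrix.det _ = _
  congr 1
  ext a j
  simp [Pi.single_apply, Matrix.one_apply, eq_comm]

/-- The coefficient of `ξ_1 ⋯ ξ_n` in an element of the exterior algebra with coefficients. -/
noncomputable def extTop (P : Type*) [Ring P] (n : ℕ) : ExtCoeff P n →ₗ[ℤ] P :=
  (TensorProduct.lid ℤ P).toLinearMap ∘ₗ TensorProduct.map (topCoeff n) LinearMap.id

@[simp] theorem extTop_tmul (n : ℕ) (x : ExteriorAlgebra ℤ (Fin n → ℤ)) (p : P) :
    extTop P n (x ⊗ₜ p) = topCoeff n x • p := rfl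

theorem extTop_twistedProd (M : Matrix ι κ P) {k : ℕ} (c : Fin k → ι) (d : Fin k → κ) :
    extTop P k (twistedProd (extMap τ k)
      (List.ofFn fun a => linForm extGen fun i => M (c i) (d a))) = twistedMinor τ M c d := by
  have expand := twistedProd_linForm τ extGen (Matrix.of fun i a => M (c i) (d a))
  simp only [Matrix.of_apply] at expand
  rw [expand, map_sum]
  simp only [extTop_tmul, topCoeff_prod]
  exact sum_det_one_submatrix_smul id fun e => twistedProd τ (List.ofFn fun a => M (c (e a)) (d a))

theorem topCoeff_prod_mul_prod {k m : ℕ} (e : Fin k → Fin (k + m)) (f : Fin m → Fin m) :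
    topCoeff (k + m) ((List.ofFn fun a => extGen (e a)).prod *
        (List.ofFn fun a => extGen (Fin.natAdd k (f a))).prod) =
      ((1 : Matrix (Fin (k + m)) (Fin (k + m)) ℤ).submatrix e (Fin.castAdd m)).det *
        ((1 : Matrix (Fin m) (Fin m) ℤ).submatrix f id).det := by
  rw [← det_one_submatrix_append, ← topCoeff_prod, ← List.prod_append, ← List.ofFn_fin_append]
  congr 3
  exact (comp_append extGen e (Fin.natAdd k ∘ f)).symm

theorem extTop_twistedProd_mul {k m : ℕ} (N : Matrix (Fin (k + m)) (Fin k) P)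
    (S : Matrix (Fin m) (Fin m) P) :
    extTop P (k + m)
      (twistedProd (extMap τ _) (List.ofFn fun a => linForm extGen fun i => N i a) *
        (extMap τ _ ^ k) (twistedProd (extMap τ _)
          (List.ofFn fun a => linForm (fun i => extGen (Fin.natAdd k i)) fun i => S i a))) =
      twistedMinor τ N (Fin.castAdd m) id * (τ ^ k) (twistedMinor τ S id id) := by
  rw [twistedProd_linForm, twistedProd_linForm, map_sum, Finset.sum_mul_sum]
  simp only [extMap_pow_tmul, Algebra.TensorProduct.tmul_mul_tmul, map_sum, extTop_tmul,
    topCoeff_prod_mul_prod, ← smul_mul_smul_comm, ← Finset.sum_mul_sum]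
  congr 1
  · exact sum_det_one_submatrix_smul (Fin.castAdd m)
      fun e => twistedProd τ (List.ofFn fun a => N (e a) a)
  · simp only [← map_zsmul, ← map_sum]
    congr 1
    exact sum_det_one_submatrix_smul id fun f => twistedProd τ (List.ofFn fun a => S (f a) a)

variable {τ} {M : Matrix ι κ P}

theorem IsTwistedManin.twistedMinor_comp_perm_right (hM : IsTwistedManin τ M) {k : ℕ}
    (c : Fin k → ι) (d : Fin k → κ) (π : Equiv.Perm (Fin k)) :
    twistedMinor τ M c (d ∘ π) = Equiv.Perm.sign π • twistedMinor τ M c d := by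
  cases k with
  | zero => simp [Subsingleton.elim π 1]
  | succ k =>
    refine comp_perm_eq_sign_smul (fun d => twistedMinor τ M c d) (fun d i => ?_) d π
    simp only [← extTop_twistedProd, ← map_neg]
    congr 1
    exact (hM.submatrix c id).twistedAnticommute.twistedProd_comp_swap d i

theorem IsTwistedManin.twistedMinor_comp_perm (hM : IsTwistedManin τ M) {k : ℕ}
    (c : Fin k → ι) (d : Fin k → κ) (π : Equiv.Perm (Fin k)) :
    twistedMinor τ M (c ∘ π) (d ∘ π) = twistedMinor τ M c d := by
  rw [twistedMinor_comp_perm_left, hM.twistedMinor_comp_perm_right, smul_smul, Int.units_mul_self,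
    one_smul]

theorem IsTwistedManin.twistedMinor_append_eliminate (hM : IsTwistedManin τ M) {k m : ℕ}
    (b : Fin k → ι) (b' : Fin k → κ) (c : Fin m → ι) (d : Fin m → κ)
    (x : Matrix (Fin k) (Fin m) P) (S : Matrix (Fin m) (Fin m) P)
    (hb : M.submatrix b d = M.submatrix b b' * x)
    (hc : M.submatrix c d = M.submatrix c b' * x + S) :
    twistedMinor τ M (Fin.append b c) (Fin.append b' d) =
      twistedMinor τ M b b' * (τ ^ k) (twistedMinor τ S id id) := by
  set Ψ : κ → ExtCoeff P (k + m) := fun j => linForm extGen fun i => M (Fin.append b c i) j with hΨ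
  set ψ : Fin m → ExtCoeff P (k + m) := fun j =>
    linForm (fun i => extGen (Fin.natAdd k i)) fun i => S i j with hψ
  have decomposition (j : Fin m) : Ψ (d j) = ∑ γ, Ψ (b' γ) * (1 ⊗ₜ x γ j) + ψ j := by
    have hbj (β : Fin k) : M (b β) (d j) = ∑ γ, M (b β) (b' γ) * x γ j := congrFun₂ hb β j
    have hcj (i : Fin m) : M (c i) (d j) = ∑ γ, M (c i) (b' γ) * x γ j + S i j := congrFun₂ hc i j
    simp only [hΨ, hψ, linForm, Finset.sum_mul, Algebra.TensorProduct.tmul_mul_tmul, mul_one]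
    rw [Finset.sum_comm]
    simp only [Fin.sum_univ_add, Fin.append_left, Fin.append_right, ← tmul_sum, hbj, hcj]
    rw [add_assoc, ← Finset.sum_add_distrib]
    simp only [← tmul_add]
  have anticommute : TwistedAnticommute (extMap τ _) Ψ :=
    (hM.submatrix (Fin.append b c) id).twistedAnticommute
  have split : (List.ofFn fun a => Ψ (Fin.append b' d a)) =
      (List.ofFn b').map Ψ ++ (List.ofFn id).map (Ψ ∘ d) := by
    rw [List.map_ofFn, List.map_ofFn, ← List.ofFn_fin_append]
    exact congrArg List.ofFn (comp_append Ψ b' d)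
  have factor := extTop_twistedProd_mul τ (Matrix.of fun i a => M (Fin.append b c i) (b' a)) S
  have corner : twistedMinor τ (Matrix.of fun i a => M (Fin.append b c i) (b' a))
      (Fin.castAdd m) id = twistedMinor τ M b b' := by
    simp only [twistedMinor, Matrix.of_apply, Fin.append_left, id]
  rw [← extTop_twistedProd, split, anticommute.twistedProd_append_eliminate (by simp) decomposition,
    twistedProd_append, List.map_ofFn, List.map_ofFn, List.length_ofFn, ← corner, ← factor]
  rfl

end TwistedMinor

section Antisymmetrizer

variable {R : Type*} [Ring R] {n k : ℕ}

theorem antisymmetrizer_mul_apply (L : Matrix (Fin k → Fin n) (Fin k → Fin n) R)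
    (c d : Fin k → Fin n) :
    (antisymmetrizer R n k * L) c d =
      ∑ σ : Equiv.Perm (Fin k), Equiv.Perm.sign σ • L (c ∘ σ) d := by
  simp only [Matrix.mul_apply, antisymmetrizer, Matrix.of_apply, Finset.sum_mul]
  rw [Finset.sum_comm]
  refine Fintype.sum_equiv (Equiv.inv _) _ _ fun σ => ?_
  rw [Finset.sum_eq_single (c ∘ ⇑σ⁻¹)]
  · rw [if_pos (by ext; simp)]
    simp [Units.smul_def]
  · intro e _ he
    rw [if_neg, zero_mul]
    rintro rfl
    exact he (by ext; simp)
  · simp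

theorem mul_antisymmetrizer_apply (L : Matrix (Fin k → Fin n) (Fin k → Fin n) R)
    (c d : Fin k → Fin n) :
    (L * antisymmetrizer R n k) c d =
      ∑ σ : Equiv.Perm (Fin k), Equiv.Perm.sign σ • L c (d ∘ σ) := by
  simp only [Matrix.mul_apply, antisymmetrizer, Matrix.of_apply, Finset.mul_sum]
  rw [Finset.sum_comm]
  refine Finset.sum_congr rfl fun σ _ => ?_
  rw [Finset.sum_eq_single (d ∘ σ)]
  · simp only [if_true, Units.smul_def, zsmul_eq_mul]
    exact ((Int.cast_commute _ _).eq).symm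
  · intro e _ he
    rw [if_neg he, mul_zero]
  · simp

theorem eq_zero_of_not_injective {G X : Type*} [AddCommGroup G] [IsAddTorsionFree G]
    {F : (Fin k → X) → G} (hF : ∀ d (π : Equiv.Perm (Fin k)), F (d ∘ π) = Equiv.Perm.sign π • F d)
    {d : Fin k → X} (hd : ¬ Function.Injective d) : F d = 0 := by
  simp only [Function.Injective, not_forall] at hd
  obtain ⟨a, b, hab, hne⟩ := hd
  have swap_fixes : d ∘ Equiv.swap a b = d := by
    rw [Equiv.comp_swap_eq_update, hab, Function.update_eq_self, ← hab, Function.update_eq_self]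
  have h := hF d (Equiv.swap a b)
  rwa [swap_fixes, Equiv.Perm.sign_swap hne, Units.neg_smul, one_smul, self_eq_neg] at h

theorem eq_of_alternating {G : Type*} [AddCommGroup G] [IsAddTorsionFree G]
    {F F' : (Fin n → Fin n) → (Fin n → Fin n) → G}
    (hrow : ∀ c d (π : Equiv.Perm (Fin n)), F (c ∘ π) d = Equiv.Perm.sign π • F c d)
    (hcol : ∀ c d (π : Equiv.Perm (Fin n)), F c (d ∘ π) = Equiv.Perm.sign π • F c d)
    (hrow' : ∀ c d (π : Equiv.Perm (Fin n)), F' (c ∘ π) d = Equiv.Perm.sign π • F' c d)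
    (hcol' : ∀ c d (π : Equiv.Perm (Fin n)), F' c (d ∘ π) = Equiv.Perm.sign π • F' c d)
    (h : F id id = F' id id) : F = F' := by
  have eq_perm {e : Fin n → Fin n} (he : Function.Injective e) :
      ∃ π : Equiv.Perm (Fin n), e = id ∘ π :=
    ⟨Equiv.ofBijective e (Finite.injective_iff_bijective.mp he), rfl⟩
  funext c d
  by_cases hc : Function.Injective c
  · by_cases hd : Function.Injective d
    · obtain ⟨σ, rfl⟩ := eq_perm hc
      obtain ⟨π, rfl⟩ := eq_perm hd
      rw [hrow, hcol, hrow', hcol', h]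
    · rw [eq_zero_of_not_injective (hcol c) hd, eq_zero_of_not_injective (hcol' c) hd]
  · rw [eq_zero_of_not_injective (F := (F · d)) (hrow · d) hc,
      eq_zero_of_not_injective (F := (F' · d)) (hrow' · d) hc]

theorem antisymmetrizer_comp_perm_left (c d : Fin k → Fin n) (π : Equiv.Perm (Fin k)) :
    antisymmetrizer R n k (c ∘ π) d = Equiv.Perm.sign π • antisymmetrizer R n k c d := by
  simp only [antisymmetrizer, Matrix.of_apply, Finset.smul_sum]
  refine Fintype.sum_equiv (Equiv.mulRight π⁻¹) _ _ fun σ => ?_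
  have comp_eq_iff : c ∘ π = d ∘ σ ↔ c = d ∘ ⇑(σ * π⁻¹) := by
    rw [Equiv.Perm.coe_mul, ← Function.comp_assoc]
    exact (Equiv.eq_comp_symm π c (d ∘ σ)).symm
  simp only [comp_eq_iff, Equiv.coe_mulRight, smul_ite, smul_zero, Equiv.Perm.sign_mul,
    Equiv.Perm.sign_inv, Units.smul_def, zsmul_eq_mul, ← Int.cast_mul, ← Units.val_mul]
  rw [mul_comm (Equiv.Perm.sign σ), ← mul_assoc, Int.units_mul_self, one_mul]

theorem antisymmetrizer_comp_perm_right (c d : Fin k → Fin n) (π : Equiv.Perm (Fin k)) :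
    antisymmetrizer R n k c (d ∘ π) = Equiv.Perm.sign π • antisymmetrizer R n k c d := by
  simp only [antisymmetrizer, Matrix.of_apply, Finset.smul_sum]
  refine Fintype.sum_equiv (Equiv.mulLeft π) _ _ fun σ => ?_
  simp only [Equiv.coe_mulLeft, smul_ite, smul_zero, Equiv.Perm.sign_mul, Equiv.Perm.coe_mul,
    Function.comp_assoc, Units.smul_def, zsmul_eq_mul, ← Int.cast_mul, ← Units.val_mul,
    ← mul_assoc, Int.units_mul_self, one_mul]

theorem antisymmetrizer_id_id : antisymmetrizer R n n id id = 1 := by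
  have id_eq_iff (σ : Equiv.Perm (Fin n)) : (id : Fin n → Fin n) = ⇑σ ↔ σ = 1 := by
    rw [← Equiv.Perm.coe_one, DFunLike.coe_fn_eq, eq_comm]
  simp [antisymmetrizer, id_eq_iff]

theorem eq_smul_antisymmetrizer [IsAddTorsionFree R]
    {L : Matrix (Fin n → Fin n) (Fin n → Fin n) R}
    (hrow : ∀ c d (π : Equiv.Perm (Fin n)), L (c ∘ π) d = Equiv.Perm.sign π • L c d)
    (hcol : ∀ c d (π : Equiv.Perm (Fin n)), L c (d ∘ π) = Equiv.Perm.sign π • L c d) :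
    L = L id id • antisymmetrizer R n n := by
  refine eq_of_alternating hrow hcol (fun c d π => ?_) (fun c d π => ?_) ?_
  · rw [Matrix.smul_apply, antisymmetrizer_comp_perm_left, smul_comm, Matrix.smul_apply]
  · rw [Matrix.smul_apply, antisymmetrizer_comp_perm_right, smul_comm, Matrix.smul_apply]
  · rw [Matrix.smul_apply, antisymmetrizer_id_id, smul_eq_mul, mul_one]

end Antisymmetrizer

section QuantumMinors

theorem prod_map_leg {R : Type*} [Ring R] {n k : ℕ} (N : Fin k → Matrix (Fin n) (Fin n) R)
    (l : List (Fin k)) (hl : l.Nodup) (c d : Fin k → Fin n) :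
    (l.map fun a => leg a (N a)).prod c d =
      if ∀ b, b ∉ l → c b = d b then (l.map fun a => N a (c a) (d a)).prod else 0 := by
  induction l generalizing c with
  | nil => simp [Matrix.one_apply, funext_iff]
  | cons a l ih =>
    obtain ⟨ha, hl⟩ := List.nodup_cons.mp hl
    rw [List.map_cons, List.prod_cons, Matrix.mul_apply,
      Finset.sum_eq_single (Function.update c a (d a))]
    · have update_agrees : (∀ b, b ∉ l → Function.update c a (d a) b = d b) ↔
          ∀ b, b ∉ a :: l → c b = d b := by
        refine forall_congr' fun b => ?_
        by_cases hb : b = a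
        · subst hb; simp
        · simp [hb]
      have map_update : (l.map fun b => N b (Function.update c a (d a) b) (d b)) =
          l.map fun b => N b (c b) (d b) := by
        refine List.map_congr_left fun b hb => ?_
        rw [Function.update_of_ne (by rintro rfl; exact ha hb)]
      rw [ih hl, leg, Matrix.of_apply, if_pos (fun b hb => by simp [hb])]
      simp only [update_agrees, map_update, Function.update_self, List.map_cons, List.prod_cons,
        mul_ite, mul_zero]
    · intro e _ he
      rw [ih hl, leg, Matrix.of_apply]
      split_ifs with hce hed
      · refine absurd (funext fun b => ?_) he
        by_cases hb : b = a
        · subst hb; simpa using hed b ha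
        · simpa [hb] using (hce b hb).symm
      all_goals simp
    · simp

variable {A : Type*} [Ring A] [Algebra ℂ A] {n k : ℕ}

theorem quantumMinor_eq_twistedMinor (M : Matrix (Fin n) (Fin n) A⟦X⟧) (c d : Fin k → Fin n) :
    quantumMinor M c d = twistedMinor (shiftHom A 1) M c d := by
  rw [quantumMinor, antisymmetrizer_mul_apply, twistedMinor, legs, List.ofFn_eq_map]
  refine Finset.sum_congr rfl fun σ _ => ?_
  rw [prod_map_leg _ _ (List.nodup_finRange k),
    if_pos (fun b hb => absurd (List.mem_finRange b) hb), twistedProd_ofFn, List.ofFn_eq_map]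
  simp only [Matrix.map_apply, shift_natCast, Function.comp_apply]

/-- The transpose of a matrix over the opposite ring. Passing to it reverses products, and so turns
statements about `A_k M_1(u) ⋯ M_k(u - k + 1)` into statements about
`M_k(u - k + 1) ⋯ M_1(u) A_k`. -/
def opTranspose {P ι κ : Type*} (M : Matrix ι κ P) : Matrix κ ι Pᵐᵒᵖ :=
  M.transpose.map MulOpposite.op

@[simp] theorem opTranspose_apply {P ι κ : Type*} (M : Matrix ι κ P) (i : κ) (j : ι) :
    opTranspose M i j = MulOpposite.op (M j i) := rfl

theorem op_pow_apply {P : Type*} [Ring P] (τ : P →+* P) (r : ℕ) (x : P) :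
    (RingHom.op τ ^ r) (MulOpposite.op x) = MulOpposite.op ((τ ^ r) x) := by
  induction r with
  | zero => rfl
  | succ r ih =>
    rw [pow_succ_apply, ih, pow_succ_apply]
    rfl

theorem op_legs_reverse_mul_antisymmetrizer (M : Matrix (Fin n) (Fin n) A⟦X⟧)
    (c d : Fin k → Fin n) :
    MulOpposite.op (((legs k M).reverse.prod * antisymmetrizer A⟦X⟧ n k) c d) =
      twistedMinor (RingHom.op (shiftHom A 1)) (opTranspose M) d c := by
  rw [mul_antisymmetrizer_apply, twistedMinor, Finset.op_sum, legs, List.ofFn_eq_map,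
    ← List.map_reverse]
  refine Finset.sum_congr rfl fun σ _ => ?_
  rw [prod_map_leg _ _ (List.nodup_reverse.mpr (List.nodup_finRange k)),
    if_pos (fun b hb => absurd (List.mem_reverse.mpr (List.mem_finRange b)) hb),
    twistedProd_ofFn, List.ofFn_eq_map, MulOpposite.op_smul, MulOpposite.op_list_prod]
  simp only [Matrix.map_apply, shift_natCast, List.map_reverse, List.reverse_reverse, List.map_map,
    Function.comp_def, opTranspose_apply, op_pow_apply]

theorem isQuantumDet_qdet {M : Matrix (Fin n) (Fin n) A⟦X⟧}
    (hM : IsTwistedManin (shiftHom A 1) M)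
    (hM' : IsTwistedManin (RingHom.op (shiftHom A 1)) (opTranspose M))
    (h : twistedMinor (RingHom.op (shiftHom A 1)) (opTranspose M) id id =
      MulOpposite.op (twistedMinor (shiftHom A 1) M id id)) :
    IsQuantumDet M (qdet M) := by
  have : IsAddTorsionFree A⟦X⟧ := .of_isTorsionFree ℂ _
  have rows : (legs n M).reverse.prod * antisymmetrizer A⟦X⟧ n n = Matrix.of fun c d =>
      (twistedMinor (RingHom.op (shiftHom A 1)) (opTranspose M) d c).unop := by
    ext1 c d
    rw [Matrix.of_apply, ← op_legs_reverse_mul_antisymmetrizer, MulOpposite.unop_op]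
  constructor
  · refine eq_smul_antisymmetrizer (fun c d π => ?_) (fun c d π => ?_)
    · change quantumMinor M _ _ = _ • quantumMinor M _ _
      simp only [quantumMinor_eq_twistedMinor, twistedMinor_comp_perm_left]
    · change quantumMinor M _ _ = _ • quantumMinor M _ _
      simp only [quantumMinor_eq_twistedMinor, hM.twistedMinor_comp_perm_right]
  · have qdet_eq : qdet M = ((legs n M).reverse.prod * antisymmetrizer A⟦X⟧ n n) id id := by
      rw [rows, Matrix.of_apply, h, MulOpposite.unop_op]
      exact quantumMinor_eq_twistedMinor M id id
    rw [qdet_eq]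
    refine eq_smul_antisymmetrizer (fun c d π => ?_) (fun c d π => ?_)
    · rw [rows, Matrix.of_apply, hM'.twistedMinor_comp_perm_right, MulOpposite.unop_smul]
      rfl
    · rw [rows, Matrix.of_apply, twistedMinor_comp_perm_left, MulOpposite.unop_smul]
      rfl

end QuantumMinors

section TwoVariables

variable {A : Type*} [Ring A]

/-- A series in `u⁻¹` as a series in the two variables `u⁻¹`, `v⁻¹`, where the inner variable of
`A⟦X⟧⟦X⟧` stands for `u⁻¹` and the outer one for `v⁻¹`. -/
noncomputable def inU : A⟦X⟧ →+* A⟦X⟧⟦X⟧ := C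

/-- A series in `v⁻¹` as a series in the two variables `u⁻¹`, `v⁻¹`. -/
noncomputable def inV : A⟦X⟧ →+* A⟦X⟧⟦X⟧ := PowerSeries.map C

/-- The coefficient of `u⁻ʳ v⁻ˢ`. -/
noncomputable def coeffUV (r s : ℕ) : A⟦X⟧⟦X⟧ →+ A :=
  (coeff r).toAddMonoidHom.comp (coeff (R := A⟦X⟧) s).toAddMonoidHom

theorem coeffUV_apply (r s : ℕ) (G : A⟦X⟧⟦X⟧) : coeffUV r s G = coeff r (coeff s G) := rfl

@[simp] theorem coeffUV_inU_mul_inV (r s : ℕ) (f g : A⟦X⟧) :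
    coeffUV r s (inU f * inV g) = coeff r f * coeff s g := by
  simp [coeffUV_apply, inU, inV]

@[simp] theorem coeffUV_inV_mul_inU (r s : ℕ) (f g : A⟦X⟧) :
    coeffUV r s (inV g * inU f) = coeff s g * coeff r f := by
  simp [coeffUV_apply, inU, inV]

theorem coeffUV_ext {G H : A⟦X⟧⟦X⟧} (h : ∀ r s, coeffUV r s G = coeffUV r s H) : G = H := by
  ext s r
  exact h r s

variable (A) in
/-- The element `v⁻¹ - u⁻¹`. Equations with the factor `u - v` are divided by `u v`, which turns
that factor into this one. -/
noncomputable def invDiff : A⟦X⟧⟦X⟧ := X - C X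

variable (A) in
/-- The element `u⁻¹ v⁻¹`, by which equations in `u` and `v` are multiplied. -/
noncomputable def invProd : A⟦X⟧⟦X⟧ := X * C X

theorem invDiff_eq : invDiff A = inV X - inU X := by
  simp [invDiff, inU, inV]

theorem invProd_eq : invProd A = inV X * inU X := by
  simp [invProd, inU, inV]

theorem commute_C_X (G : A⟦X⟧⟦X⟧) : Commute (C X) G := by
  ext s : 1
  simp [PowerSeries.coeff_C_mul, PowerSeries.coeff_mul_C, (PowerSeries.commute_X _).eq]

theorem commute_invDiff (G : A⟦X⟧⟦X⟧) : Commute (invDiff A) G :=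
  (PowerSeries.commute_X G).symm.sub_left (commute_C_X G)

theorem commute_invProd (G : A⟦X⟧⟦X⟧) : Commute (invProd A) G :=
  (PowerSeries.commute_X G).symm.mul_left (commute_C_X G)

theorem invDiff_mul_eq_iff (G H : A⟦X⟧⟦X⟧) :
    invDiff A * G = invProd A * H ↔
      (∀ r, coeffUV r 0 G = 0) ∧ (∀ s, coeffUV 0 s G = 0) ∧
        ∀ r s, coeffUV (r + 1) s G - coeffUV r (s + 1) G = coeffUV r s H := by
  have diff_succ_succ (r s : ℕ) : coeffUV (r + 1) (s + 1) (invDiff A * G) =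
      coeffUV (r + 1) s G - coeffUV r (s + 1) G := by
    simp [coeffUV_apply, invDiff, sub_mul, PowerSeries.coeff_succ_X_mul]
  have diff_succ_zero (r : ℕ) : coeffUV (r + 1) 0 (invDiff A * G) = -coeffUV r 0 G := by
    simp only [coeffUV_apply, invDiff, sub_mul, map_sub, PowerSeries.coeff_zero_X_mul,
      PowerSeries.coeff_C_mul, PowerSeries.coeff_succ_X_mul, map_zero, zero_sub]
  have diff_zero_succ (s : ℕ) : coeffUV 0 (s + 1) (invDiff A * G) = coeffUV 0 s G := by
    simp [coeffUV_apply, invDiff, sub_mul, PowerSeries.coeff_succ_X_mul]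
  have diff_zero_zero : coeffUV 0 0 (invDiff A * G) = 0 := by
    simp [coeffUV_apply, invDiff, sub_mul]
  have prod_succ_succ (r s : ℕ) :
      coeffUV (r + 1) (s + 1) (invProd A * H) = coeffUV r s H := by
    simp [coeffUV_apply, invProd, mul_assoc, PowerSeries.coeff_succ_X_mul]
  have prod_zero_right (r : ℕ) : coeffUV r 0 (invProd A * H) = 0 := by
    simp [coeffUV_apply, invProd, mul_assoc]
  have prod_zero_succ (s : ℕ) : coeffUV 0 (s + 1) (invProd A * H) = 0 := by
    simp [coeffUV_apply, invProd, mul_assoc, PowerSeries.coeff_succ_X_mul]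
  refine ⟨fun h => ⟨fun r => ?_, fun s => ?_, fun r s => ?_⟩, ?_⟩
  · rw [← neg_eq_zero, ← diff_succ_zero, h, prod_zero_right]
  · rw [← diff_zero_succ, h, prod_zero_succ]
  · rw [← diff_succ_succ, h, prod_succ_succ]
  · rintro ⟨h_right, h_left, h_succ⟩
    refine coeffUV_ext fun r s => ?_
    rcases r with _ | r <;> rcases s with _ | s
    · rw [diff_zero_zero, prod_zero_right]
    · rw [diff_zero_succ, prod_zero_succ, h_left]
    · rw [diff_succ_zero, prod_zero_right, h_right, neg_zero]
    · rw [diff_succ_succ, prod_succ_succ, h_succ]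

theorem eq_zero_of_invDiff_mul_eq_zsmul {G : A⟦X⟧⟦X⟧} (z : ℤ)
    (h : invDiff A * G = invProd A * (z • G)) : G = 0 := by
  obtain ⟨h_right, -, h_succ⟩ := (invDiff_mul_eq_iff G _).mp h
  have coeff_eq_zero (s : ℕ) : ∀ r, coeffUV r s G = 0 := by
    induction s with
    | zero => exact h_right
    | succ s ih =>
      intro r
      have h_coeff := h_succ r s
      rwa [map_zsmul, ih, ih, smul_zero, zero_sub, neg_eq_zero] at h_coeff
  exact coeffUV_ext fun r s => by rw [coeff_eq_zero, map_zero]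

/-- The restriction of a series in `u⁻¹`, `v⁻¹` to the diagonal `u = v`. It is not multiplicative,
as `inU f` and `inV g` need not commute. -/
noncomputable def diagUV : A⟦X⟧⟦X⟧ →+ A⟦X⟧ where
  toFun G := PowerSeries.mk fun N => ∑ x ∈ antidiagonal N, coeffUV x.1 x.2 G
  map_zero' := by ext; simp
  map_add' G H := by ext; simp [Finset.sum_add_distrib]

theorem coeff_diagUV (G : A⟦X⟧⟦X⟧) (N : ℕ) :
    coeff N (diagUV G) = ∑ x ∈ antidiagonal N, coeffUV x.1 x.2 G := by
  simp [diagUV]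

@[simp] theorem diagUV_inU_mul_inV (f g : A⟦X⟧) : diagUV (inU f * inV g) = f * g := by
  ext N
  simp [coeff_diagUV, PowerSeries.coeff_mul]

@[simp] theorem diagUV_inV_mul_inU (f g : A⟦X⟧) : diagUV (inV g * inU f) = g * f := by
  ext N
  simp only [coeff_diagUV, PowerSeries.coeff_mul, coeffUV_inV_mul_inU]
  exact Finset.Nat.sum_antidiagonal_swap (f := fun x => coeff x.1 g * coeff x.2 f)

theorem diagUV_X_mul (G : A⟦X⟧⟦X⟧) : diagUV (X * G) = X * diagUV G := by
  ext N
  cases N with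
  | zero => simp [coeff_diagUV, coeffUV_apply]
  | succ N =>
    rw [PowerSeries.coeff_succ_X_mul, coeff_diagUV, coeff_diagUV,
      Finset.Nat.sum_antidiagonal_succ']
    simp [coeffUV_apply, PowerSeries.coeff_succ_X_mul]

theorem diagUV_C_X_mul (G : A⟦X⟧⟦X⟧) : diagUV (C X * G) = X * diagUV G := by
  ext N
  cases N with
  | zero => simp [coeff_diagUV, coeffUV_apply]
  | succ N =>
    rw [PowerSeries.coeff_succ_X_mul, coeff_diagUV, coeff_diagUV,
      Finset.Nat.sum_antidiagonal_succ]
    simp [coeffUV_apply, PowerSeries.coeff_succ_X_mul]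

end TwoVariables

section RMatrix

variable {R : Type*} [Ring R] {ι κ : Type*}

/-- The relation `α [p_{ij}, q_{kl}] = β (p_{kj} q_{il} - q_{kj} p_{il})` between the entries of two
matrices. It is the defining relation of the Yangian if `P = T(u)`, `Q = T(v)` and
`α : β = (u - v) : 1`. -/
def SatisfiesRTT (α β : R) (P Q : Matrix ι κ R) : Prop :=
  ∀ i j k l, α * (P i j * Q k l - Q k l * P i j) = β * (P k j * Q i l - Q k j * P i l)

theorem SatisfiesRTT.submatrix {α β : R} {P Q : Matrix ι κ R} (h : SatisfiesRTT α β P Q)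
    {ι' κ' : Type*} (f : ι' → ι) (g : κ' → κ) :
    SatisfiesRTT α β (P.submatrix f g) (Q.submatrix f g) :=
  fun _ _ _ _ => h _ _ _ _

variable [Fintype ι] [DecidableEq ι]

/-- The matrix `P` acting on the first of two tensor factors. Elements of
`R ⊗ End (R^ι) ⊗ End (R^ι)` are encoded as matrices of matrices, the outer indices belonging to the
first factor. -/
def firstLeg : Matrix ι ι R →+* Matrix ι ι (Matrix ι ι R) :=
  (Matrix.scalar ι).mapMatrix

/-- The matrix `Q` acting on the second of two tensor factors. -/
def secondLeg : Matrix ι ι R →+* Matrix ι ι (Matrix ι ι R) :=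
  Matrix.scalar ι

/-- The `R`-matrix `α - β P`, where `P` is the flip of the two tensor factors. -/
def rMatrix (ι : Type*) [Fintype ι] [DecidableEq ι] (α β : R) : Matrix ι ι (Matrix ι ι R) :=
  Matrix.diagonal (fun _ => Matrix.diagonal fun _ => α) - Matrix.of fun i j => Matrix.single j i β

theorem firstLeg_apply (P : Matrix ι ι R) (i j k l : ι) :
    firstLeg P i j k l = if k = l then P i j else 0 := by
  simp [firstLeg, Matrix.diagonal_apply]

theorem secondLeg_mul_apply (Q : Matrix ι ι R) (Y : Matrix ι ι (Matrix ι ι R)) (i j k l : ι) :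
    (secondLeg Q * Y) i j k l = ∑ q, Q k q * Y i j q l := by
  simp [secondLeg, Matrix.mul_apply (M := Q)]

theorem mul_secondLeg_apply (Y : Matrix ι ι (Matrix ι ι R)) (Q : Matrix ι ι R) (i j k l : ι) :
    (Y * secondLeg Q) i j k l = ∑ q, Y i j k q * Q q l := by
  simp [secondLeg, Matrix.mul_apply (N := Q)]

theorem firstLeg_mul_secondLeg_apply (P Q : Matrix ι ι R) (i j k l : ι) :
    (firstLeg P * secondLeg Q) i j k l = P i j * Q k l := by
  simp [firstLeg, secondLeg]

theorem secondLeg_mul_firstLeg_apply (P Q : Matrix ι ι R) (i j k l : ι) :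
    (secondLeg Q * firstLeg P) i j k l = Q k l * P i j := by
  simp [firstLeg, secondLeg]

theorem rMatrix_mul_apply (α β : R) (Y : Matrix ι ι (Matrix ι ι R)) (i j k l : ι) :
    (rMatrix ι α β * Y) i j k l = α * Y i j k l - β * Y k j i l := by
  rw [rMatrix, sub_mul, Matrix.sub_apply, Matrix.sub_apply, Matrix.diagonal_mul,
    Matrix.diagonal_mul]
  simp [Matrix.mul_apply, Matrix.sum_apply, Matrix.single_apply, ite_and]

theorem mul_rMatrix_apply (α β : R) (Y : Matrix ι ι (Matrix ι ι R)) (i j k l : ι) :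
    (Y * rMatrix ι α β) i j k l = Y i j k l * α - Y i l k j * β := by
  rw [rMatrix, mul_sub, Matrix.sub_apply, Matrix.sub_apply, Matrix.mul_diagonal,
    Matrix.mul_diagonal]
  simp [Matrix.mul_apply, Matrix.sum_apply, Matrix.single_apply, ite_and]

variable {α β : R} (hα : ∀ x, Commute α x) (hβ : ∀ x, Commute β x)
include hα hβ

theorem satisfiesRTT_iff_semiconjBy {P Q : Matrix ι ι R} :
    SatisfiesRTT α β P Q ↔
      SemiconjBy (rMatrix ι α β) (firstLeg P * secondLeg Q) (secondLeg Q * firstLeg P) := by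
  have entry (i j k l : ι) : (rMatrix ι α β * (firstLeg P * secondLeg Q)) i j k l =
      (secondLeg Q * firstLeg P * rMatrix ι α β) i j k l ↔
        α * (P i j * Q k l - Q k l * P i j) = β * (P k j * Q i l - Q k j * P i l) := by
    rw [rMatrix_mul_apply, mul_rMatrix_apply]
    simp only [firstLeg_mul_secondLeg_apply, secondLeg_mul_firstLeg_apply]
    rw [← (hα _).eq, ← (hβ _).eq, sub_eq_sub_iff_sub_eq_sub, mul_sub, mul_sub]
  exact ⟨fun h => by ext i j k l; exact (entry i j k l).mpr (h i j k l),
    fun h i j k l => (entry i j k l).mp (congrFun₂ (congrFun₂ h.eq i j) k l)⟩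

theorem satisfiesRTT_iff_semiconjBy_swap {P Q : Matrix ι ι R} :
    SatisfiesRTT α β P Q ↔
      SemiconjBy (rMatrix ι α β) (secondLeg P * firstLeg Q) (firstLeg Q * secondLeg P) := by
  have entry (i j k l : ι) : (rMatrix ι α β * (secondLeg P * firstLeg Q)) k l i j =
      (firstLeg Q * secondLeg P * rMatrix ι α β) k l i j ↔
        α * (P i j * Q k l - Q k l * P i j) = β * (P k j * Q i l - Q k j * P i l) := by
    rw [rMatrix_mul_apply, mul_rMatrix_apply]
    simp only [firstLeg_mul_secondLeg_apply, secondLeg_mul_firstLeg_apply]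
    rw [← (hα _).eq, ← (hβ _).eq, sub_eq_sub_iff_sub_eq_sub, mul_sub, mul_sub]
  exact ⟨fun h => by ext k l i j; exact (entry i j k l).mpr (h i j k l),
    fun h i j k l => (entry i j k l).mp (congrFun₂ (congrFun₂ h.eq k l) i j)⟩

theorem SatisfiesRTT.inv {P Q : (Matrix ι ι R)ˣ} (h : SatisfiesRTT α β P.val Q.val) :
    SatisfiesRTT α β Q⁻¹.val P⁻¹.val := by
  let P₁ := Units.map firstLeg.toMonoidHom P
  let Q₂ := Units.map secondLeg.toMonoidHom Q
  have h_semiconj : SemiconjBy (rMatrix ι α β) ↑(P₁ * Q₂) ↑(Q₂ * P₁) :=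
    (satisfiesRTT_iff_semiconjBy hα hβ).mp h
  have h_inv := h_semiconj.units_inv_right
  rw [mul_inv_rev, mul_inv_rev] at h_inv
  exact (satisfiesRTT_iff_semiconjBy_swap hα hβ).mpr h_inv

theorem SatisfiesRTT.mul_inv_sub_inv_mul_eq_zero {P : Matrix ι ι R} {Q : (Matrix ι ι R)ˣ}
    (h : SatisfiesRTT α β P Q.val) {i j k l : ι} (hil : i ≠ l) (hkj : k ≠ j) :
    α * (P i j * Q⁻¹.val k l - Q⁻¹.val k l * P i j) = 0 := by
  let Q₂ := Units.map secondLeg.toMonoidHom Q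
  have h_semiconj : SemiconjBy (rMatrix ι α β) (firstLeg P * Q₂.val) (Q₂.val * firstLeg P) :=
    (satisfiesRTT_iff_semiconjBy hα hβ).mp h
  have h_conj : secondLeg Q⁻¹.val * (rMatrix ι α β * firstLeg P) =
      firstLeg P * rMatrix ι α β * secondLeg Q⁻¹.val := by
    change (Q₂⁻¹).val * _ = _ * (Q₂⁻¹).val
    rw [Units.inv_mul_eq_iff_eq_mul, ← mul_assoc, Units.eq_mul_inv_iff_mul_eq, mul_assoc,
      h_semiconj.eq, mul_assoc]
  have h_entry : Q⁻¹.val k l * (α * P i j) = α * P i j * Q⁻¹.val k l := by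
    have := congrFun₂ (congrFun₂ h_conj i j) k l
    simpa [secondLeg_mul_apply, mul_secondLeg_apply, rMatrix_mul_apply, mul_rMatrix_apply,
      firstLeg_apply, hil, hkj, ← (hα _).eq] using this
  rw [mul_sub, sub_eq_zero, ← mul_assoc, ← h_entry, ← mul_assoc, ← (hα _).eq, mul_assoc]

end RMatrix

section CoeffCommute

variable {A : Type*} [Ring A]

/-- The commutation of two series with independent variables: every coefficient of `f` commutes with
every coefficient of `g`. This is stronger than `Commute f g`. -/
def CoeffCommute (f g : A⟦X⟧) : Prop :=
  ∀ r s, Commute (coeff r f) (coeff s g)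

theorem coeffCommute_iff_commute_inU_inV {f g : A⟦X⟧} :
    CoeffCommute f g ↔ Commute (inU f) (inV g) := by
  refine ⟨fun h => coeffUV_ext fun r s => ?_, fun h r s => ?_⟩
  · rw [coeffUV_inU_mul_inV, coeffUV_inV_mul_inU, (h r s).eq]
  · have := congrArg (coeffUV r s) h.eq
    rwa [coeffUV_inU_mul_inV, coeffUV_inV_mul_inU] at this

theorem CoeffCommute.symm {f g : A⟦X⟧} (h : CoeffCommute f g) : CoeffCommute g f :=
  fun r s => (h s r).symm

theorem CoeffCommute.commute {f g : A⟦X⟧} (h : CoeffCommute f g) : Commute f g := by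
  have := congrArg diagUV (coeffCommute_iff_commute_inU_inV.mp h).eq
  rwa [diagUV_inU_mul_inV, diagUV_inV_mul_inU] at this

theorem CoeffCommute.mul_left {f₁ f₂ g : A⟦X⟧} (h₁ : CoeffCommute f₁ g)
    (h₂ : CoeffCommute f₂ g) : CoeffCommute (f₁ * f₂) g := by
  rw [coeffCommute_iff_commute_inU_inV] at *
  rw [map_mul]
  exact h₁.mul_left h₂

theorem CoeffCommute.mul_right {f g₁ g₂ : A⟦X⟧} (h₁ : CoeffCommute f g₁)
    (h₂ : CoeffCommute f g₂) : CoeffCommute f (g₁ * g₂) :=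
  (h₁.symm.mul_left h₂.symm).symm

variable [Algebra ℂ A]

theorem CoeffCommute.shift_left {f g : A⟦X⟧} (a : ℂ) (h : CoeffCommute f g) :
    CoeffCommute (shift a f) g := by
  intro r s
  rw [coeff_shift a f le_rfl]
  exact Commute.sum_left _ _ _ fun _ _ => (h _ _).smul_left _

theorem CoeffCommute.shift_right {f g : A⟦X⟧} (a : ℂ) (h : CoeffCommute f g) :
    CoeffCommute f (shift a g) :=
  (h.symm.shift_left a).symm

theorem CoeffCommute.twistedProd_left {l : List A⟦X⟧} {g : A⟦X⟧} (h : ∀ f ∈ l, CoeffCommute f g) :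
    CoeffCommute (twistedProd (shiftHom A 1) l) g := by
  induction l with
  | nil => exact coeffCommute_iff_commute_inU_inV.mpr (by simp)
  | cons f l ih =>
    rw [List.forall_mem_cons] at h
    rw [twistedProd_cons]
    exact h.1.mul_left ((ih h.2).shift_left 1)

theorem CoeffCommute.twistedMinor_left {ι κ : Type*} {M : Matrix ι κ A⟦X⟧} {k : ℕ}
    {c : Fin k → ι} {d : Fin k → κ} {g : A⟦X⟧} (h : ∀ i j, CoeffCommute (M (c i) (d j)) g) :
    CoeffCommute (twistedMinor (shiftHom A 1) M c d) g := by
  rw [coeffCommute_iff_commute_inU_inV, twistedMinor, map_sum]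
  refine Commute.sum_left _ _ _ fun σ _ => ?_
  have h_prod : CoeffCommute
      (twistedProd (shiftHom A 1) (List.ofFn fun a => M (c (σ a)) (d a))) g :=
    CoeffCommute.twistedProd_left fun f hf => by
      obtain ⟨a, rfl⟩ := List.mem_ofFn.mp hf
      exact h _ _
  rw [Units.smul_def, map_zsmul]
  exact (coeffCommute_iff_commute_inU_inV.mp h_prod).smul_left _

end CoeffCommute

section MatrixInverse

variable {R ι κ : Type*} [Ring R] [Fintype ι] [DecidableEq ι] [Fintype κ] [DecidableEq κ]

theorem commute_scalar_iff {x : R} {M : Matrix ι ι R} :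
    Commute (Matrix.scalar ι x) M ↔ ∀ i j, Commute x (M i j) := by
  rw [Matrix.scalar_commute_iff, ← Matrix.ext_iff]
  rfl

/-- The Schur complement of the lower right block of a block matrix. If that block is not
invertible, then it is replaced by `0` in place of its inverse. -/
noncomputable def schurComplement (M : Matrix (ι ⊕ κ) (ι ⊕ κ) R) : Matrix ι ι R :=
  M.toBlocks₁₁ - M.toBlocks₁₂ * Ring.inverse M.toBlocks₂₂ * M.toBlocks₂₁

theorem schurComplement_mul_toBlocks₁₁ {M W : Matrix (ι ⊕ κ) (ι ⊕ κ) R}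
    (hM : IsUnit M.toBlocks₂₂) (hMW : M * W = 1) : schurComplement M * W.toBlocks₁₁ = 1 := by
  rw [← Matrix.fromBlocks_toBlocks M, ← Matrix.fromBlocks_toBlocks W, Matrix.fromBlocks_multiply,
    ← Matrix.fromBlocks_one, Matrix.fromBlocks_inj] at hMW
  obtain ⟨h₁₁, -, h₂₁, -⟩ := hMW
  have h_inv : Ring.inverse M.toBlocks₂₂ * (M.toBlocks₂₁ * W.toBlocks₁₁) = -W.toBlocks₂₁ := by
    rw [eq_neg_of_add_eq_zero_left h₂₁, Matrix.mul_neg, ← Matrix.mul_assoc,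
      Ring.inverse_mul_cancel _ hM, Matrix.one_mul]
  rw [schurComplement, Matrix.sub_mul, Matrix.mul_assoc, Matrix.mul_assoc, h_inv, Matrix.mul_neg,
    sub_neg_eq_add, h₁₁]

theorem toBlocks₁₁_mul_schurComplement {M W : Matrix (ι ⊕ κ) (ι ⊕ κ) R}
    (hM : IsUnit M.toBlocks₂₂) (hWM : W * M = 1) : W.toBlocks₁₁ * schurComplement M = 1 := by
  rw [← Matrix.fromBlocks_toBlocks M, ← Matrix.fromBlocks_toBlocks W, Matrix.fromBlocks_multiply,
    ← Matrix.fromBlocks_one, Matrix.fromBlocks_inj] at hWM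
  obtain ⟨h₁₁, h₁₂, -, -⟩ := hWM
  have h_inv : W.toBlocks₁₁ * M.toBlocks₁₂ * Ring.inverse M.toBlocks₂₂ = -W.toBlocks₁₂ := by
    rw [eq_neg_of_add_eq_zero_left h₁₂, Matrix.neg_mul, Matrix.mul_assoc,
      Ring.mul_inverse_cancel _ hM, Matrix.mul_one]
  rw [schurComplement, Matrix.mul_sub, ← Matrix.mul_assoc, ← Matrix.mul_assoc, h_inv,
    Matrix.neg_mul, sub_neg_eq_add, h₁₁]

/-- The Schur complement of an invertible block matrix as an invertible matrix, whose inverse is a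
block of the inverse matrix. -/
noncomputable def schurComplementUnit (M : (Matrix (ι ⊕ κ) (ι ⊕ κ) R)ˣ)
    (hM : IsUnit M.val.toBlocks₂₂) : (Matrix ι ι R)ˣ where
  val := schurComplement M.val
  inv := M⁻¹.val.toBlocks₁₁
  val_inv := schurComplement_mul_toBlocks₁₁ hM M.mul_inv
  inv_val := toBlocks₁₁_mul_schurComplement hM M.inv_mul

end MatrixInverse

section ConstantTermOne

variable {A ι κ : Type*} [Ring A] [Fintype ι] [DecidableEq ι] [Fintype κ] [DecidableEq κ]

/-- A matrix of power series as a power series of matrices. -/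
noncomputable def matrixPowerSeriesEquiv : Matrix ι ι A⟦X⟧ ≃+* (Matrix ι ι A)⟦X⟧ where
  toFun M := PowerSeries.mk fun r => M.map (coeff r)
  invFun F := Matrix.of fun i j => PowerSeries.mk fun r => coeff r F i j
  left_inv M := by ext; simp
  right_inv F := by ext; simp
  map_add' M N := by ext; simp
  map_mul' M N := by
    ext r i j
    simp only [PowerSeries.coeff_mk, Matrix.map_apply, Matrix.mul_apply, map_sum,
      PowerSeries.coeff_mul, Matrix.sum_apply]
    exact Finset.sum_comm

theorem isUnit_of_isUnit_map_constantCoeff {M : Matrix ι ι A⟦X⟧}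
    (hM : IsUnit (M.map constantCoeff)) : IsUnit M := by
  rw [← isUnit_map_iff matrixPowerSeriesEquiv, PowerSeries.isUnit_iff_constantCoeff]
  convert hM using 1
  ext i j
  simp [matrixPowerSeriesEquiv, ← PowerSeries.coeff_zero_eq_constantCoeff_apply,
    -PowerSeries.coeff_zero_eq_constantCoeff]

omit [Fintype ι] [Fintype κ] in
theorem map_constantCoeff_submatrix_eq_one {M : Matrix ι ι A⟦X⟧}
    (hM : M.map constantCoeff = 1) {e : κ → ι} (he : e.Injective) :
    (M.submatrix e e).map constantCoeff = 1 := by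
  rw [← Matrix.submatrix_map, hM, Matrix.submatrix_one e he]

omit [Fintype ι] in
theorem isUnit_toBlocks₂₂_of_map_constantCoeff {M : Matrix (ι ⊕ κ) (ι ⊕ κ) A⟦X⟧}
    (hM : M.map constantCoeff = 1) : IsUnit M.toBlocks₂₂ :=
  isUnit_of_isUnit_map_constantCoeff
    ((map_constantCoeff_submatrix_eq_one hM Sum.inr_injective).symm ▸ isUnit_one)

omit [Fintype ι] in
theorem schurComplement_map_constantCoeff {M : Matrix (ι ⊕ κ) (ι ⊕ κ) A⟦X⟧}
    (hM : M.map constantCoeff = 1) : (schurComplement M).map constantCoeff = 1 := by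
  have h₁₁ : M.toBlocks₁₁.map constantCoeff = 1 :=
    map_constantCoeff_submatrix_eq_one hM Sum.inl_injective
  have h₂₁ : M.toBlocks₂₁.map constantCoeff = 0 := by
    ext i j
    exact congrFun₂ hM (Sum.inr i) (Sum.inl j)
  rw [schurComplement, Matrix.map_sub _ (map_sub _), Matrix.map_mul, h₁₁, h₂₁, Matrix.mul_zero,
    sub_zero]

end ConstantTermOne

section RTT

variable {A ι κ : Type*} [Ring A]

/-- The matrices `M(u)` whose entries satisfy the defining relation
`(u - v) [m_{ij}(u), m_{kl}(v)] = m_{kj}(u) m_{il}(v) - m_{kj}(v) m_{il}(u)` of the Yangian. -/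
def IsRTT (M : Matrix ι κ A⟦X⟧) : Prop :=
  SatisfiesRTT (invDiff A) (invProd A) (M.map inU) (M.map inV)

theorem IsRTT.submatrix {M : Matrix ι κ A⟦X⟧} (hM : IsRTT M) {ι' κ' : Type*} (f : ι' → ι)
    (g : κ' → κ) : IsRTT (M.submatrix f g) :=
  SatisfiesRTT.submatrix hM f g

theorem isRTT_iff_coeff {M : Matrix ι κ A⟦X⟧} :
    IsRTT M ↔ ∀ i j k l,
      (∀ r, Commute (coeff r (M i j)) (coeff 0 (M k l))) ∧
      (∀ r, Commute (coeff 0 (M i j)) (coeff r (M k l))) ∧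
      ∀ r s, ⁅coeff (r + 1) (M i j), coeff s (M k l)⁆ - ⁅coeff r (M i j), coeff (s + 1) (M k l)⁆ =
        coeff r (M k j) * coeff s (M i l) - coeff s (M k j) * coeff r (M i l) := by
  simp only [IsRTT, SatisfiesRTT, Matrix.map_apply, invDiff_mul_eq_iff, map_sub,
    coeffUV_inU_mul_inV, coeffUV_inV_mul_inU, sub_eq_zero, Ring.lie_def]
  rfl

theorem IsRTT.coeffCommute_self {M : Matrix ι κ A⟦X⟧} (hM : IsRTT M) (i : ι) (j : κ) :
    CoeffCommute (M i j) (M i j) := by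
  rw [coeffCommute_iff_commute_inU_inV, commute_iff_eq, ← sub_eq_zero]
  exact eq_zero_of_invDiff_mul_eq_zsmul 1 (by rw [one_zsmul]; exact hM i j i j)

variable [Fintype ι] [DecidableEq ι] [Fintype κ] [DecidableEq κ]

theorem IsRTT.schurComplement {M : Matrix (ι ⊕ κ) (ι ⊕ κ) A⟦X⟧} (hM : IsRTT M)
    (h_unit : IsUnit M) (h₂₂ : IsUnit M.toBlocks₂₂) : IsRTT (schurComplement M) := by
  obtain ⟨M, rfl⟩ := h_unit
  let MU : (Matrix (ι ⊕ κ) (ι ⊕ κ) A⟦X⟧⟦X⟧)ˣ := Units.map (inU (A := A)).mapMatrix.toMonoidHom M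
  let MV : (Matrix (ι ⊕ κ) (ι ⊕ κ) A⟦X⟧⟦X⟧)ˣ := Units.map (inV (A := A)).mapMatrix.toMonoidHom M
  let S := schurComplementUnit M h₂₂
  let SU : (Matrix ι ι A⟦X⟧⟦X⟧)ˣ := Units.map (inU (A := A)).mapMatrix.toMonoidHom S
  let SV : (Matrix ι ι A⟦X⟧⟦X⟧)ˣ := Units.map (inV (A := A)).mapMatrix.toMonoidHom S
  have h_inv : SatisfiesRTT (invDiff A) (invProd A) MV⁻¹.val MU⁻¹.val :=
    SatisfiesRTT.inv commute_invDiff commute_invProd hM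
  have h_block : SatisfiesRTT (invDiff A) (invProd A) SV⁻¹.val SU⁻¹.val :=
    h_inv.submatrix Sum.inl Sum.inl
  have h_S := h_block.inv commute_invDiff commute_invProd
  rwa [inv_inv, inv_inv] at h_S

theorem IsRTT.coeffCommute_toBlocks₂₂_schurComplement {M : Matrix (ι ⊕ κ) (ι ⊕ κ) A⟦X⟧}
    (hM : IsRTT M) (h_unit : IsUnit M) (h₂₂ : IsUnit M.toBlocks₂₂) (p q : κ) (i j : ι) :
    CoeffCommute (M.toBlocks₂₂ p q) (Yangian.schurComplement M i j) := by
  obtain ⟨M, rfl⟩ := h_unit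
  let MV : (Matrix (ι ⊕ κ) (ι ⊕ κ) A⟦X⟧⟦X⟧)ˣ := Units.map (inV (A := A)).mapMatrix.toMonoidHom M
  let SV : (Matrix ι ι A⟦X⟧⟦X⟧)ˣ :=
    Units.map (inV (A := A)).mapMatrix.toMonoidHom (schurComplementUnit M h₂₂)
  have h_RTT : SatisfiesRTT (invDiff A) (invProd A) (M.val.map inU) MV.val := hM
  have h_inv (k l : ι) : Commute (inU (M.val.toBlocks₂₂ p q)) (SV⁻¹.val k l) := by
    have h := h_RTT.mul_inv_sub_inv_mul_eq_zero commute_invDiff commute_invProd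
      (i := Sum.inr p) (j := Sum.inr q) (k := Sum.inl k) (l := Sum.inl l)
      Sum.inr_ne_inl Sum.inl_ne_inr
    exact sub_eq_zero.mp (eq_zero_of_invDiff_mul_eq_zsmul 0 (by rwa [zero_smul, mul_zero]))
  have h_S : Commute (Matrix.scalar ι (inU (M.val.toBlocks₂₂ p q))) SV.val :=
    Commute.units_inv_right_iff.mp (commute_scalar_iff.mpr h_inv)
  exact coeffCommute_iff_commute_inU_inV.mpr (commute_scalar_iff.mp h_S i j)

end RTT

section ShiftRTT

variable {A ι κ : Type*} [Ring A] [Algebra ℂ A]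

theorem shift_inU (a : ℂ) (f : A⟦X⟧) : shift a (inU f) = inU f :=
  shift_C a f

theorem shift_inV (a : ℂ) (f : A⟦X⟧) : shift a (inV f) = inV (shift a f) :=
  shift_map a { C with commutes' := fun _ => PowerSeries.algebraMap_apply.symm } f

variable (A) in
/-- The substitution `u ↦ u - a`, `v ↦ v - a` in series in `u⁻¹`, `v⁻¹`. -/
noncomputable def shiftUV (a : ℂ) : A⟦X⟧⟦X⟧ →+* A⟦X⟧⟦X⟧ :=
  (shiftHom A⟦X⟧ a).comp (PowerSeries.map (shiftHom A a))

theorem shiftUV_inU (a : ℂ) (f : A⟦X⟧) : shiftUV A a (inU f) = inU (shift a f) := by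
  simp [shiftUV, inU, shift_C]

theorem shiftUV_inV (a : ℂ) (f : A⟦X⟧) : shiftUV A a (inV f) = inV (shift a f) := by
  have h_inner : PowerSeries.map (shiftHom A a) (inV f) = inV f := by
    ext s : 1
    simp [inV, shift_C]
  rw [shiftUV, RingHom.comp_apply, h_inner, shiftHom_apply, shift_inV]

theorem commute_inU_one_sub (a : ℂ) (G : A⟦X⟧⟦X⟧) :
    Commute (inU (1 - algebraMap ℂ A⟦X⟧ a * X)) G := by
  have h_algebraMap : inU (algebraMap ℂ A⟦X⟧ a) = algebraMap ℂ A⟦X⟧⟦X⟧ a :=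
    PowerSeries.algebraMap_apply.symm
  rw [map_sub, map_one, map_mul, h_algebraMap]
  exact (Commute.one_left G).sub_left
    ((Algebra.commute_algebraMap_left a G).mul_left (commute_C_X G))

theorem one_sub_mul_shiftUV_invDiff (a : ℂ) :
    inU (1 - algebraMap ℂ A⟦X⟧ a * X) * inV (1 - algebraMap ℂ A⟦X⟧ a * X) *
      shiftUV A a (invDiff A) = invDiff A := by
  have h_algebraMap : inU (algebraMap ℂ A⟦X⟧ a) = inV (algebraMap ℂ A⟦X⟧ a) := by
    simp [inU, inV, PowerSeries.algebraMap_apply]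
  have h_X : Commute (inU X) (inV (X : A⟦X⟧)) := commute_C_X _
  calc _ = inU (1 - algebraMap ℂ A⟦X⟧ a * X) *
          inV ((1 - algebraMap ℂ A⟦X⟧ a * X) * shift a X) -
        inV (1 - algebraMap ℂ A⟦X⟧ a * X) *
          inU ((1 - algebraMap ℂ A⟦X⟧ a * X) * shift a X) := by
        rw [invDiff_eq, map_sub (shiftUV A a), shiftUV_inU, shiftUV_inV, mul_sub, map_mul inV,
          map_mul inU, mul_assoc, mul_assoc, (commute_inU_one_sub a _).left_comm (inU _)]
    _ = inV X - inU X := by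
        rw [one_sub_mul_shift_X, map_sub, map_sub, map_mul, map_mul, map_one, map_one, sub_mul,
          sub_mul, one_mul, one_mul, h_algebraMap, mul_assoc, mul_assoc, h_X.eq,
          sub_sub_sub_cancel_right]
    _ = invDiff A := invDiff_eq.symm

theorem one_sub_mul_shiftUV_invProd (a : ℂ) :
    inU (1 - algebraMap ℂ A⟦X⟧ a * X) * inV (1 - algebraMap ℂ A⟦X⟧ a * X) *
      shiftUV A a (invProd A) = invProd A := by
  rw [invProd_eq, map_mul (shiftUV A a), shiftUV_inU, shiftUV_inV, mul_assoc, ← mul_assoc (inV _),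
    (commute_inU_one_sub a (inV _ * inV _)).left_comm, ← map_mul, ← map_mul, one_sub_mul_shift_X]

theorem IsRTT.map_shift {M : Matrix ι κ A⟦X⟧} (hM : IsRTT M) (a : ℂ) : IsRTT (M.map (shift a)) := by
  intro i j k l
  have h_shift := congrArg (fun G => inU (1 - algebraMap ℂ A⟦X⟧ a * X) *
    inV (1 - algebraMap ℂ A⟦X⟧ a * X) * shiftUV A a G) (hM i j k l)
  beta_reduce at h_shift
  simp only [map_mul, ← mul_assoc] at h_shift
  rw [one_sub_mul_shiftUV_invDiff, one_sub_mul_shiftUV_invProd] at h_shift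
  simpa only [Matrix.map_apply, map_sub, map_mul, shiftUV_inU, shiftUV_inV] using h_shift

/-- The substitution `v ↦ v - 1` turns `u - v` into `u - v + 1`, which is `1` on the diagonal. -/
theorem diagUV_eq_of_shift_one {G H : A⟦X⟧⟦X⟧}
    (h : shift 1 (invDiff A) * G = shift 1 (invProd A) * H) : diagUV G = diagUV H := by
  have h_X : (1 - X) * shift 1 X = (X : A⟦X⟧⟦X⟧) := by
    simpa using one_sub_mul_shift_X (A := A⟦X⟧) 1
  have h_diff : (1 - X) * shift 1 (invDiff A) = X * C X - (C X - X) := by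
    rw [invDiff, ← shiftHom_apply, map_sub, shiftHom_apply, shiftHom_apply, shift_C, mul_sub, h_X]
    noncomm_ring
  have h_prod : (1 - X) * shift 1 (invProd A) = X * C X := by
    rw [invProd, shift_mul, shift_C, ← mul_assoc, h_X]
  have h_diag : X * (X * diagUV G) = X * (X * diagUV H) := by
    have h_mul : (1 - X) * shift 1 (invDiff A) * G = (1 - X) * shift 1 (invProd A) * H := by
      rw [mul_assoc, h, mul_assoc]
    rw [h_diff, h_prod] at h_mul
    simpa only [sub_mul, map_sub, mul_assoc, diagUV_X_mul, diagUV_C_X_mul, sub_self,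
      sub_zero] using congrArg diagUV h_mul
  exact PowerSeries.X_mul_cancel (PowerSeries.X_mul_cancel h_diag)

theorem IsRTT.mul_shift_one_sub {M : Matrix ι κ A⟦X⟧} (hM : IsRTT M) (i : ι) (j : κ) (k : ι)
    (l : κ) :
    M i j * shift 1 (M k l) - M k j * shift 1 (M i l) =
      shift 1 (M k l) * M i j - shift 1 (M k j) * M i l := by
  have h_shift := congrArg (shiftHom A⟦X⟧ 1) (hM i j k l)
  simp only [Matrix.map_apply, map_mul, map_sub, shiftHom_apply, shift_inU, shift_inV] at h_shift
  have h_diag := diagUV_eq_of_shift_one h_shift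
  simp only [map_sub, diagUV_inU_mul_inV, diagUV_inV_mul_inU] at h_diag
  rwa [sub_eq_sub_iff_sub_eq_sub]

theorem IsRTT.isTwistedManin {M : Matrix ι κ A⟦X⟧} (hM : IsRTT M) :
    IsTwistedManin (shiftHom A 1) M where
  column i k j := sub_eq_zero.mp ((hM.mul_shift_one_sub i j k j).trans (sub_self _))
  cross i k j l := by
    have h := hM.mul_shift_one_sub i j k l
    have h' := hM.mul_shift_one_sub i l k j
    simp only [shiftHom_apply]
    grind

theorem IsRTT.isTwistedManin_opTranspose {M : Matrix ι κ A⟦X⟧} (hM : IsRTT M) :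
    IsTwistedManin (RingHom.op (shiftHom A 1)) (opTranspose M) where
  column i k j := MulOpposite.unop_injective
    (sub_eq_zero.mp ((hM.mul_shift_one_sub j i j k).symm.trans (sub_self _)))
  cross i k j l := by
    apply MulOpposite.unop_injective
    have h := hM.mul_shift_one_sub j i l k
    have h' := hM.mul_shift_one_sub l i j k
    simp only [opTranspose_apply, RingHom.op_apply_apply, MulOpposite.unop_op, shiftHom_apply,
      MulOpposite.unop_add, MulOpposite.unop_mul]
    grind

end ShiftRTT

section MinorFactorization

theorem opTranspose_mul {P ι κ μ : Type*} [Ring P] [Fintype κ] (M : Matrix ι κ P)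
    (N : Matrix κ μ P) : opTranspose (M * N) = opTranspose N * opTranspose M := by
  ext i j
  simp [Matrix.mul_apply]

theorem opTranspose_one {P κ : Type*} [Ring P] [DecidableEq κ] :
    opTranspose (1 : Matrix κ κ P) = 1 := by
  ext i j
  simp [Matrix.one_apply, eq_comm, apply_ite MulOpposite.op]

/-- The transpose over the opposite ring of an invertible matrix as an invertible matrix. -/
def opTransposeUnit {P κ : Type*} [Ring P] [Fintype κ] [DecidableEq κ] (M : (Matrix κ κ P)ˣ) :
    (Matrix κ κ Pᵐᵒᵖ)ˣ where
  val := opTranspose M.val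
  inv := opTranspose M⁻¹.val
  val_inv := by rw [← opTranspose_mul, M.inv_mul, opTranspose_one]
  inv_val := by rw [← opTranspose_mul, M.mul_inv, opTranspose_one]

theorem isUnit_opTranspose {P κ : Type*} [Ring P] [Fintype κ] [DecidableEq κ]
    {M : Matrix κ κ P} (hM : IsUnit M) : IsUnit (opTranspose M) :=
  (opTransposeUnit hM.unit).isUnit

theorem inverse_opTranspose {P κ : Type*} [Ring P] [Fintype κ] [DecidableEq κ]
    {M : Matrix κ κ P} (hM : IsUnit M) :
    Ring.inverse (opTranspose M) = opTranspose (Ring.inverse M) := by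
  obtain ⟨M, rfl⟩ := hM
  rw [Ring.inverse_unit]
  exact Ring.inverse_unit (opTransposeUnit M)

theorem schurComplement_opTranspose {P ι κ : Type*} [Ring P] [Fintype κ] [DecidableEq κ]
    {M : Matrix (ι ⊕ κ) (ι ⊕ κ) P} (h₂₂ : IsUnit M.toBlocks₂₂) :
    schurComplement (opTranspose M) = opTranspose (schurComplement M) := by
  change opTranspose M.toBlocks₁₁ - opTranspose M.toBlocks₂₁ *
    Ring.inverse (opTranspose M.toBlocks₂₂) * opTranspose M.toBlocks₁₂ = _
  rw [inverse_opTranspose h₂₂, Matrix.mul_assoc, ← opTranspose_mul, ← opTranspose_mul]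
  rfl

theorem IsTwistedManin.twistedMinor_append_schurComplement {P ι : Type*} [Ring P] {τ : P →+* P}
    {k m : ℕ} {M : Matrix (ι ⊕ Fin k) (ι ⊕ Fin k) P} (hM : IsTwistedManin τ M)
    (h₂₂ : IsUnit M.toBlocks₂₂) (c d : Fin m → ι) :
    twistedMinor τ M (Fin.append Sum.inr (Sum.inl ∘ c)) (Fin.append Sum.inr (Sum.inl ∘ d)) =
      twistedMinor τ M.toBlocks₂₂ id id * (τ ^ k) (twistedMinor τ (schurComplement M) c d) := by
  refine hM.twistedMinor_append_eliminate Sum.inr Sum.inr (Sum.inl ∘ c) (Sum.inl ∘ d)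
    ((Ring.inverse M.toBlocks₂₂ * M.toBlocks₂₁).submatrix id d)
    ((schurComplement M).submatrix c d) ?_ ?_
  · change M.toBlocks₂₁.submatrix id d =
      (M.toBlocks₂₂ * (Ring.inverse M.toBlocks₂₂ * M.toBlocks₂₁)).submatrix id d
    rw [← Matrix.mul_assoc, Ring.mul_inverse_cancel _ h₂₂, Matrix.one_mul]
  · change M.toBlocks₁₁.submatrix c d =
      (M.toBlocks₁₂ * (Ring.inverse M.toBlocks₂₂ * M.toBlocks₂₁) + schurComplement M).submatrix c d
    rw [schurComplement, Matrix.mul_assoc, add_sub_cancel]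

end MinorFactorization

section QuantumDeterminant

variable {A : Type*} [Ring A] [Algebra ℂ A]

theorem twistedMinor_fin_one {P ι κ : Type*} [Ring P] (τ : P →+* P)
    (M : Matrix ι κ P) (c : Fin 1 → ι) (d : Fin 1 → κ) : twistedMinor τ M c d = M (c 0) (d 0) := by
  simp [twistedMinor]

theorem IsRTT.exists_twistedMinor_eq_mul {k : ℕ} {M : Matrix (Fin (k + 1)) (Fin (k + 1)) A⟦X⟧}
    (hM : IsRTT M) (h_one : M.map constantCoeff = 1) :
    ∃ s : A⟦X⟧, CoeffCommute s s ∧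
      (∀ i j, CoeffCommute (M.submatrix Fin.castSucc Fin.castSucc i j) s) ∧
      twistedMinor (shiftHom A 1) M id id =
        twistedMinor (shiftHom A 1) (M.submatrix Fin.castSucc Fin.castSucc) id id *
          shift (k : ℂ) s ∧
      twistedMinor (RingHom.op (shiftHom A 1)) (opTranspose M) id id =
        twistedMinor (RingHom.op (shiftHom A 1))
          (opTranspose (M.submatrix Fin.castSucc Fin.castSucc)) id id *
          MulOpposite.op (shift (k : ℂ) s) := by
  let e : Fin 1 ⊕ Fin k → Fin (k + 1) := Sum.elim (Fin.natAdd k) (Fin.castAdd 1)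
  have he : e.Injective := by
    rintro (a | a) (b | b) h <;> simp [e, Fin.ext_iff] at h ⊢ <;> omega
  have e_append : id = e ∘ Fin.append Sum.inr (Sum.inl ∘ id) := by
    rw [comp_append]
    exact Fin.append_castAdd_natAdd.symm
  have hN : IsRTT (M.submatrix e e) := hM.submatrix e e
  have hN_one := map_constantCoeff_submatrix_eq_one h_one he
  have h_unit : IsUnit (M.submatrix e e) :=
    isUnit_of_isUnit_map_constantCoeff (hN_one.symm ▸ isUnit_one)
  have h₂₂ := isUnit_toBlocks₂₂_of_map_constantCoeff hN_one
  refine ⟨Yangian.schurComplement (M.submatrix e e) 0 0,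
    (hN.schurComplement h_unit h₂₂).coeffCommute_self 0 0,
    fun i j => hN.coeffCommute_toBlocks₂₂_schurComplement h_unit h₂₂ i j 0 0, ?_, ?_⟩
  · have h := hN.isTwistedManin.twistedMinor_append_schurComplement h₂₂ id id
    rw [twistedMinor_fin_one] at h
    rw [e_append, shift_natCast]
    exact h
  · have h := hN.isTwistedManin_opTranspose.twistedMinor_append_schurComplement
      (isUnit_opTranspose h₂₂) id id
    rw [twistedMinor_fin_one, schurComplement_opTranspose h₂₂, opTranspose_apply, op_pow_apply] at h
    rw [e_append, shift_natCast]
    exact h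

theorem IsRTT.twistedMinor_opTranspose {k : ℕ} {M : Matrix (Fin k) (Fin k) A⟦X⟧} (hM : IsRTT M)
    (h_one : M.map constantCoeff = 1) :
    twistedMinor (RingHom.op (shiftHom A 1)) (opTranspose M) id id =
      MulOpposite.op (twistedMinor (shiftHom A 1) M id id) := by
  induction k with
  | zero => simp [twistedMinor]
  | succ k ih =>
    obtain ⟨s, -, h_comm, h_col, h_row⟩ := hM.exists_twistedMinor_eq_mul h_one
    have h_comm_minor : CoeffCommute (twistedMinor (shiftHom A 1)
        (M.submatrix Fin.castSucc Fin.castSucc) id id) s := .twistedMinor_left h_comm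
    rw [h_row, h_col, ih (hM.submatrix _ _)
      (map_constantCoeff_submatrix_eq_one h_one (Fin.castSucc_injective k)), ← MulOpposite.op_mul,
      (h_comm_minor.shift_right _).commute.eq]

theorem IsRTT.coeffCommute_twistedMinor_self {k : ℕ} {M : Matrix (Fin k) (Fin k) A⟦X⟧}
    (hM : IsRTT M) (h_one : M.map constantCoeff = 1) :
    CoeffCommute (twistedMinor (shiftHom A 1) M id id) (twistedMinor (shiftHom A 1) M id id) := by
  induction k with
  | zero => exact CoeffCommute.twistedMinor_left fun i => i.elim0
  | succ k ih =>
    obtain ⟨s, hs, h_comm, h_col, -⟩ := hM.exists_twistedMinor_eq_mul h_one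
    have h_minor := ih (hM.submatrix _ _)
      (map_constantCoeff_submatrix_eq_one h_one (Fin.castSucc_injective k))
    have h_comm_minor : CoeffCommute (twistedMinor (shiftHom A 1)
        (M.submatrix Fin.castSucc Fin.castSucc) id id) (shift (k : ℂ) s) :=
      (CoeffCommute.twistedMinor_left h_comm).shift_right _
    rw [h_col]
    exact (h_minor.mul_right h_comm_minor).mul_left
      (h_comm_minor.symm.mul_right ((hs.shift_left _).shift_right _))

theorem constantCoeff_twistedMinor {k : ℕ} {M : Matrix (Fin k) (Fin k) A⟦X⟧}
    (h_one : M.map constantCoeff = 1) :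
    constantCoeff (twistedMinor (shiftHom A 1) M id id) = 1 := by
  rw [← twistedMinor_map (τ' := RingHom.id A) _ fun f => (constantCoeff_shift 1 f).symm, h_one,
    twistedMinor_one]

theorem IsRTT.isQuantumDet {k : ℕ} {M : Matrix (Fin k) (Fin k) A⟦X⟧} (hM : IsRTT M)
    (h_one : M.map constantCoeff = 1) : IsQuantumDet M (qdet M) :=
  isQuantumDet_qdet hM.isTwistedManin hM.isTwistedManin_opTranspose
    (hM.twistedMinor_opTranspose h_one)

end QuantumDeterminant

section Sylvester

theorem twistedMinor_eq_of_bijective {P : Type*} [Ring P] {τ : P →+* P} {n k : ℕ}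
    {M : Matrix (Fin n) (Fin n) P} (hM : IsTwistedManin τ M) {c : Fin k → Fin n}
    (hc : c.Bijective) : twistedMinor τ M c c = twistedMinor τ M id id := by
  obtain rfl : k = n := by simpa using Fintype.card_of_bijective hc
  exact hM.twistedMinor_comp_perm id id (Equiv.ofBijective c hc)

theorem cons_eq_append_comp_finRotate_symm {Y : Type*} {k : ℕ} (y : Y) (b : Fin k → Y) :
    (Fin.cons y b : Fin (k + 1) → Y) = Fin.append b ![y] ∘ (finRotate (k + 1)).symm := by
  rw [Equiv.eq_comp_symm]
  ext a
  cases a using Fin.lastCases with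
  | last =>
    rw [Function.comp_apply, finRotate_last, Fin.cons_zero]
    exact (Fin.append_right b ![y] 0).symm
  | cast a =>
    rw [Function.comp_apply, finRotate_apply, Fin.coeSucc_eq_succ, Fin.cons_succ]
    exact (Fin.append_left b ![y] a).symm

/-- The matrix of the minors of `M` which have one row and one column, put first, besides those of
the lower right block. For `M = T(u)` this is the matrix `T̃(u)`. -/
def borderedMinors {P : Type*} [Ring P] (τ : P →+* P) {ι : Type*} {k : ℕ}
    (M : Matrix (ι ⊕ Fin k) (ι ⊕ Fin k) P) : Matrix ι ι P :=
  Matrix.of fun i j =>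
    twistedMinor τ M (Fin.cons (Sum.inl i) Sum.inr) (Fin.cons (Sum.inl j) Sum.inr)

theorem IsTwistedManin.borderedMinors_eq_smul {P : Type*} [Ring P] {τ : P →+* P} {ι : Type*}
    {k : ℕ} {M : Matrix (ι ⊕ Fin k) (ι ⊕ Fin k) P} (hM : IsTwistedManin τ M)
    (h₂₂ : IsUnit M.toBlocks₂₂) :
    borderedMinors τ M =
      twistedMinor τ M.toBlocks₂₂ id id • (schurComplement M).map (τ ^ k) := by
  ext1 i j
  have inl_comp (i : ι) : (![Sum.inl i] : Fin 1 → ι ⊕ Fin k) = Sum.inl ∘ ![i] := by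
    ext1 a
    rw [Subsingleton.elim a 0]
    rfl
  have h := hM.twistedMinor_append_schurComplement h₂₂ ![i] ![j]
  rw [twistedMinor_fin_one] at h
  rw [borderedMinors, Matrix.of_apply, cons_eq_append_comp_finRotate_symm,
    cons_eq_append_comp_finRotate_symm, hM.twistedMinor_comp_perm, inl_comp, inl_comp]
  exact h

theorem IsRTT.smul {A ι κ : Type*} [Ring A] {M : Matrix ι κ A⟦X⟧} (hM : IsRTT M) {g : A⟦X⟧}
    (hgg : CoeffCommute g g) (hg : ∀ i j, CoeffCommute g (M i j)) : IsRTT (g • M) := by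
  have inU_mul_inV (i : ι) (j : κ) (k : ι) (l : κ) : inU (g * M i j) * inV (g * M k l) =
      inU g * inV g * (inU (M i j) * inV (M k l)) := by
    rw [map_mul, map_mul,
      (coeffCommute_iff_commute_inU_inV.mp (hg i j).symm).mul_mul_mul_comm]
  have inV_mul_inU (i : ι) (j : κ) (k : ι) (l : κ) : inV (g * M k l) * inU (g * M i j) =
      inU g * inV g * (inV (M k l) * inU (M i j)) := by
    rw [map_mul, map_mul,
      (coeffCommute_iff_commute_inU_inV.mp (hg k l)).symm.mul_mul_mul_comm,
      (coeffCommute_iff_commute_inU_inV.mp hgg).eq]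
  intro i j k l
  have h := hM i j k l
  simp only [Matrix.map_apply, Matrix.smul_apply, smul_eq_mul] at h ⊢
  rw [inU_mul_inV, inV_mul_inU, inU_mul_inV, inV_mul_inU, ← mul_sub, ← mul_sub,
    (commute_invDiff (inU g * inV g)).left_comm, h, (commute_invProd (inU g * inV g)).left_comm]

variable {A : Type*} [Ring A] [Algebra ℂ A]

theorem twistedProd_map_mul_left {g : A⟦X⟧} {l : List A⟦X⟧} (hl : ∀ x ∈ l, CoeffCommute g x) :
    twistedProd (shiftHom A 1) (l.map (g * ·)) =
      twistedProd (shiftHom A 1) (List.replicate l.length g) * twistedProd (shiftHom A 1) l := by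
  induction l with
  | nil => simp
  | cons x l ih =>
    rw [List.forall_mem_cons] at hl
    have h_comm : CoeffCommute (twistedProd (shiftHom A 1) (List.replicate l.length g)) x :=
      .twistedProd_left fun y hy => List.eq_of_mem_replicate hy ▸ hl.1
    rw [List.map_cons, twistedProd_cons, ih hl.2, List.length_cons, List.replicate_succ,
      twistedProd_cons, twistedProd_cons, map_mul, shiftHom_apply,
      (h_comm.shift_left 1).symm.commute.mul_mul_mul_comm]

theorem twistedMinor_smul {ι κ : Type*} {M : Matrix ι κ A⟦X⟧} {g : A⟦X⟧}
    (hg : ∀ i j, CoeffCommute g (M i j)) {k : ℕ} (c : Fin k → ι) (d : Fin k → κ) :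
    twistedMinor (shiftHom A 1) (g • M) c d =
      twistedProd (shiftHom A 1) (List.replicate k g) * twistedMinor (shiftHom A 1) M c d := by
  rw [twistedMinor, twistedMinor, Finset.mul_sum]
  refine Finset.sum_congr rfl fun σ _ => ?_
  have h := twistedProd_map_mul_left (g := g) (l := List.ofFn fun a => M (c (σ a)) (d a))
    fun x hx => by
      obtain ⟨a, rfl⟩ := List.mem_ofFn.mp hx
      exact hg _ _
  rw [List.length_ofFn, List.map_ofFn] at h
  rw [mul_smul_comm, ← h]
  rfl

theorem prod_map_shift_range (g : A⟦X⟧) (m : ℕ) :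
    ((List.range m).map fun k => shift ((k + 1 : ℕ) : ℂ) g).prod =
      shift 1 (twistedProd (shiftHom A 1) (List.replicate m g)) := by
  rw [← List.ofFn_const, twistedProd_ofFn, ← shiftHom_apply, map_list_prod, List.map_ofFn,
    List.ofFn_eq_map, ← List.map_coe_finRange_eq_range, List.map_map]
  simp only [shift_natCast, pow_succ_apply, Function.comp_def]

variable {ι : Type*} [DecidableEq ι] {k : ℕ}
  {M : Matrix (ι ⊕ Fin k) (ι ⊕ Fin k) A⟦X⟧}

theorem IsRTT.borderedMinors_eq_smul (hM : IsRTT M) (h_one : M.map constantCoeff = 1) :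
    borderedMinors (shiftHom A 1) M =
      twistedMinor (shiftHom A 1) M.toBlocks₂₂ id id •
        (Yangian.schurComplement M).map (shift (k : ℂ)) := by
  rw [hM.isTwistedManin.borderedMinors_eq_smul (isUnit_toBlocks₂₂_of_map_constantCoeff h_one),
    funext (shift_natCast k)]

theorem IsRTT.borderedMinors_map_constantCoeff (hM : IsRTT M) (h_one : M.map constantCoeff = 1) :
    (Yangian.borderedMinors (shiftHom A 1) M).map constantCoeff = 1 := by
  have h_minor : constantCoeff (twistedMinor (shiftHom A 1) M.toBlocks₂₂ id id) = 1 :=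
    constantCoeff_twistedMinor (map_constantCoeff_submatrix_eq_one h_one Sum.inr_injective)
  rw [hM.borderedMinors_eq_smul h_one, ← schurComplement_map_constantCoeff h_one]
  ext i j
  simp only [Matrix.map_apply, Matrix.smul_apply, smul_eq_mul, map_mul, h_minor,
    constantCoeff_shift, one_mul]

variable [Finite ι]

theorem IsRTT.coeffCommute_twistedMinor_schurComplement (hM : IsRTT M)
    (h_one : M.map constantCoeff = 1) (i j : ι) :
    CoeffCommute (twistedMinor (shiftHom A 1) M.toBlocks₂₂ id id)
      (Yangian.schurComplement M i j) := by
  have := Fintype.ofFinite ι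
  exact .twistedMinor_left fun p q => hM.coeffCommute_toBlocks₂₂_schurComplement
    (isUnit_of_isUnit_map_constantCoeff (h_one.symm ▸ isUnit_one))
    (isUnit_toBlocks₂₂_of_map_constantCoeff h_one) p q i j

theorem IsRTT.borderedMinors (hM : IsRTT M) (h_one : M.map constantCoeff = 1) :
    IsRTT (borderedMinors (shiftHom A 1) M) := by
  have := Fintype.ofFinite ι
  have h_unit : IsUnit M := isUnit_of_isUnit_map_constantCoeff (h_one.symm ▸ isUnit_one)
  have h₂₂ := isUnit_toBlocks₂₂_of_map_constantCoeff h_one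
  have h_block : IsRTT M.toBlocks₂₂ := hM.submatrix Sum.inr Sum.inr
  rw [hM.borderedMinors_eq_smul h_one]
  exact ((hM.schurComplement h_unit h₂₂).map_shift k).smul
    (h_block.coeffCommute_twistedMinor_self
      (map_constantCoeff_submatrix_eq_one h_one Sum.inr_injective))
    fun i j => (hM.coeffCommute_twistedMinor_schurComplement h_one i j).shift_right k

theorem IsRTT.twistedMinor_borderedMinors {m k : ℕ}
    {M : Matrix (Fin (m + 1) ⊕ Fin k) (Fin (m + 1) ⊕ Fin k) A⟦X⟧} (hM : IsRTT M)
    (h_one : M.map constantCoeff = 1) :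
    twistedMinor (shiftHom A 1) (Yangian.borderedMinors (shiftHom A 1) M) id id =
      twistedMinor (shiftHom A 1) M (Fin.append Sum.inr Sum.inl) (Fin.append Sum.inr Sum.inl) *
        ((List.range m).map fun r => shift ((r + 1 : ℕ) : ℂ)
          (twistedMinor (shiftHom A 1) M.toBlocks₂₂ id id)).prod := by
  set g := twistedMinor (shiftHom A 1) M.toBlocks₂₂ id id with hg
  set S := twistedMinor (shiftHom A 1) (Yangian.schurComplement M) id id
  have h_comm (i j : Fin (m + 1)) : CoeffCommute g (Yangian.schurComplement M i j) :=
    hM.coeffCommute_twistedMinor_schurComplement h_one i j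
  have full_minor : twistedMinor (shiftHom A 1) M (Fin.append Sum.inr Sum.inl)
      (Fin.append Sum.inr Sum.inl) = g * shift (k : ℂ) S := by
    rw [shift_natCast]
    exact hM.isTwistedManin.twistedMinor_append_schurComplement
      (isUnit_toBlocks₂₂_of_map_constantCoeff h_one) id id
  have minor_shift : twistedMinor (shiftHom A 1)
      ((Yangian.schurComplement M).map (shift (k : ℂ))) id id = shift (k : ℂ) S :=
    twistedMinor_map (ρ := shiftHom A k) _
      (fun f => by simp only [shiftHom_apply, shift_shift, add_comm]) _ _ _
  have h_comm_prod : CoeffCommute (twistedProd (shiftHom A 1) (List.replicate m g))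
      (shift (k : ℂ) S) :=
    .twistedProd_left fun f hf => List.eq_of_mem_replicate hf ▸
      (CoeffCommute.twistedMinor_left fun i j => (h_comm i j).symm).symm.shift_right _
  calc twistedMinor (shiftHom A 1) (Yangian.borderedMinors (shiftHom A 1) M) id id
    _ = g * shift 1 (twistedProd (shiftHom A 1) (List.replicate m g)) * shift (k : ℂ) S := by
      rw [hM.borderedMinors_eq_smul h_one, ← hg,
        twistedMinor_smul (M := (Yangian.schurComplement M).map (shift (k : ℂ)))
          fun i j => (h_comm i j).shift_right _,
        minor_shift, List.replicate_succ, twistedProd_cons, shiftHom_apply]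
    _ = g * shift (k : ℂ) S * shift 1 (twistedProd (shiftHom A 1) (List.replicate m g)) :=
      (h_comm_prod.shift_left 1).commute.right_comm g
    _ = _ := by rw [full_minor, prod_map_shift_range]

end Sylvester

section Generators

theorem coeff_T (n : ℕ) (i j : Fin n) (r : ℕ) : coeff r (T n i j) = t n i j r := by
  simp [T]

theorem t_zero (n : ℕ) (i j : Fin n) : t n i j 0 = if i = j then 1 else 0 := by
  simp only [t, freeGen]
  split_ifs <;> simp

theorem T_map_constantCoeff (n : ℕ) : (T n).map constantCoeff = 1 := by
  ext i j
  rw [Matrix.map_apply, ← PowerSeries.coeff_zero_eq_constantCoeff_apply, coeff_T, t_zero,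
    Matrix.one_apply]

theorem lie_t_sub_lie_t (n : ℕ) (i j k l : Fin n) (r s : ℕ) :
    ⁅t n i j (r + 1), t n k l s⁆ - ⁅t n i j r, t n k l (s + 1)⁆ =
      t n k j r * t n i l s - t n k j s * t n i l r := by
  have h := RingQuot.mkAlgHom_rel ℂ (Rel.mk i j k l r s)
  simp only [Ring.lie_def, map_sub, map_mul] at h
  exact h

theorem isRTT_T (n : ℕ) : IsRTT (T n) := by
  rw [isRTT_iff_coeff]
  intro i j k l
  simp only [coeff_T]
  refine ⟨fun r => ?_, fun r => ?_, lie_t_sub_lie_t n i j k l⟩ <;>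
    · rw [t_zero]
      split_ifs <;> simp

theorem existsUnique_algHom_of_isRTT {A : Type*} [Ring A] [Algebra ℂ A] {m : ℕ}
    {M : Matrix (Fin m) (Fin m) A⟦X⟧} (hM : IsRTT M) (h_one : M.map constantCoeff = 1) :
    ∃! φ : Yangian m →ₐ[ℂ] A, ∀ i j : Fin m,
      PowerSeries.map (φ : Yangian m →+* A) (T m i j) = M i j := by
  let ψ : FreeAlgebra ℂ (Fin m × Fin m × ℕ) →ₐ[ℂ] A :=
    FreeAlgebra.lift ℂ fun x => coeff (x.2.2 + 1) (M x.1 x.2.1)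
  have ψ_freeGen (i j : Fin m) (r : ℕ) : ψ (freeGen m i j r) = coeff r (M i j) := by
    cases r with
    | zero =>
      have h := congrFun₂ h_one i j
      rw [Matrix.map_apply, Matrix.one_apply] at h
      rw [PowerSeries.coeff_zero_eq_constantCoeff_apply, h, freeGen]
      split_ifs <;> simp
    | succ r => simp [ψ, freeGen]
  have ψ_rel ⦃x y : FreeAlgebra ℂ (Fin m × Fin m × ℕ)⦄ (h : Rel m x y) : ψ x = ψ y := by
    obtain ⟨i, j, k, l, r, s⟩ := h
    simpa only [Ring.lie_def, map_sub, map_mul, ψ_freeGen] using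
      (isRTT_iff_coeff.mp hM i j k l).2.2 r s
  have φ_t (i j : Fin m) (r : ℕ) :
      RingQuot.liftAlgHom ℂ ⟨ψ, ψ_rel⟩ (t m i j r) = coeff r (M i j) :=
    (RingQuot.liftAlgHom_mkAlgHom_apply ℂ ψ ψ_rel _).trans (ψ_freeGen i j r)
  refine ⟨RingQuot.liftAlgHom ℂ ⟨ψ, ψ_rel⟩, fun i j => ?_, fun φ hφ => ?_⟩
  · ext r
    rw [PowerSeries.coeff_map, coeff_T]
    exact φ_t i j r
  · refine RingQuot.ringQuot_ext' ℂ _ _ (FreeAlgebra.hom_ext (funext fun ⟨i, j, r⟩ => ?_))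
    have h := congrArg (coeff (r + 1)) (hφ i j)
    rw [PowerSeries.coeff_map, coeff_T] at h
    exact h.trans (φ_t i j (r + 1)).symm

end Generators

section Blocks

theorem append_inr_inl_bijective (k m : ℕ) :
    (Fin.append Sum.inr Sum.inl : Fin (k + m) → Fin m ⊕ Fin k).Bijective := by
  convert (finSumFinEquiv.symm.trans (Equiv.sumComm (Fin k) (Fin m))).bijective
  ext1 a
  cases a using Fin.addCases <;> simp

variable {m n : ℕ} (h : m ≤ n)

/-- The decomposition of the indices `1, …, n` into `1, …, m` and `B = {m+1, …, n}`. -/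
def blockEquiv : Fin m ⊕ Fin (n - m) ≃ Fin n :=
  finSumFinEquiv.trans (finCongr (Nat.add_sub_cancel' h))

/-- The matrix `T(u)` in block form, with the lower right block `T(u)_{BB}`. -/
noncomputable def blockT :
    Matrix (Fin m ⊕ Fin (n - m)) (Fin m ⊕ Fin (n - m)) (Yangian n)⟦X⟧ :=
  (T n).submatrix (blockEquiv h) (blockEquiv h)

theorem isRTT_blockT : IsRTT (blockT h) :=
  (isRTT_T n).submatrix _ _

theorem blockT_map_constantCoeff : (blockT h).map constantCoeff = 1 :=
  map_constantCoeff_submatrix_eq_one (T_map_constantCoeff n) (blockEquiv h).injective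

theorem TBB_eq_toBlocks₂₂ : TBB h = (blockT h).toBlocks₂₂ := rfl

theorem blockEquiv_comp_cons (i : Fin m) :
    blockEquiv h ∘ Fin.cons (Sum.inl i) Sum.inr = tupleConsB h i := by
  ext1 a
  cases a using Fin.cases <;> rfl

theorem Ttilde_eq_borderedMinors : Ttilde h = borderedMinors (shiftHom _ 1) (blockT h) := by
  ext1 i j
  rw [Ttilde, Matrix.of_apply, quantumMinor_eq_twistedMinor, ← blockEquiv_comp_cons,
    ← blockEquiv_comp_cons]
  rfl

theorem qdet_T_eq_twistedMinor_blockT : qdet (T n) =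
    twistedMinor (shiftHom _ 1) (blockT h) (Fin.append Sum.inr Sum.inl)
      (Fin.append Sum.inr Sum.inl) := by
  rw [qdet, quantumMinor_eq_twistedMinor]
  exact (twistedMinor_eq_of_bijective (isRTT_T n).isTwistedManin
    ((blockEquiv h).bijective.comp (append_inr_inl_bijective _ _))).symm

theorem isRTT_TBB : IsRTT (TBB h) :=
  (isRTT_blockT h).submatrix Sum.inr Sum.inr

theorem TBB_map_constantCoeff : (TBB h).map constantCoeff = 1 :=
  map_constantCoeff_submatrix_eq_one (blockT_map_constantCoeff h) Sum.inr_injective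

theorem isRTT_Ttilde : IsRTT (Ttilde h) :=
  Ttilde_eq_borderedMinors h ▸ (isRTT_blockT h).borderedMinors (blockT_map_constantCoeff h)

theorem Ttilde_map_constantCoeff : (Ttilde h).map constantCoeff = 1 :=
  Ttilde_eq_borderedMinors h ▸
    (isRTT_blockT h).borderedMinors_map_constantCoeff (blockT_map_constantCoeff h)

theorem qdet_Ttilde_succ {m n : ℕ} (h : m + 1 ≤ n) :
    qdet (Ttilde h) =
      qdet (T n) * ((List.range m).map fun k => shift ((k + 1 : ℕ) : ℂ) (qdet (TBB h))).prod := by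
  rw [qdet_T_eq_twistedMinor_blockT h, TBB_eq_toBlocks₂₂, Ttilde_eq_borderedMinors, qdet, qdet,
    quantumMinor_eq_twistedMinor, quantumMinor_eq_twistedMinor]
  exact (isRTT_blockT h).twistedMinor_borderedMinors (blockT_map_constantCoeff h)

end Blocks

end Yangian

theorem mainTheorem7 (m n : ℕ) (hm : 1 ≤ m) (hmn : m ≤ n) :
    (∃! φ : Yangian m →ₐ[ℂ] Yangian n,
      ∀ i j : Fin m,
        PowerSeries.map (φ : Yangian m →+* Yangian n) (Yangian.T m i j) = Yangian.Ttilde hmn i j) ∧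
    Yangian.IsQuantumDet (Yangian.T n) (Yangian.qdet (Yangian.T n)) ∧
    Yangian.IsQuantumDet (Yangian.TBB hmn) (Yangian.qdet (Yangian.TBB hmn)) ∧
    Yangian.IsQuantumDet (Yangian.Ttilde hmn) (Yangian.qdet (Yangian.Ttilde hmn)) ∧
    Yangian.qdet (Yangian.Ttilde hmn) =
      Yangian.qdet (Yangian.T n) *
        ((List.range (m - 1)).map fun k =>
          Yangian.shift ((k + 1 : ℕ) : ℂ) (Yangian.qdet (Yangian.TBB hmn))).prod := by
  open Yangian in
  refine ⟨existsUnique_algHom_of_isRTT (isRTT_Ttilde hmn) (Ttilde_map_constantCoeff hmn),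
    (isRTT_T n).isQuantumDet (T_map_constantCoeff n),
    (isRTT_TBB hmn).isQuantumDet (TBB_map_constantCoeff hmn),
    (isRTT_Ttilde hmn).isQuantumDet (Ttilde_map_constantCoeff hmn), ?_⟩
  obtain ⟨m, rfl⟩ := Nat.exists_eq_add_of_le' hm
  exact Yangian.qdet_Ttilde_succ hmn
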